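/- Write an integer partition $\lambda$ as its Ferrers diagram $\mathrm{dg}(\lambda)$ with left-justified rows, weakly decreasing from top to bottom. For a cell $x\in\mathrm{dg}(\lambda)$ let the arm $a(x)$ be the number of cells strictly to the right of $x$ in its row and the leg $l(x)$ the number of cells strictly below $x$ in its column. Put $\mathrm{area}(\lambda)=|\lambda|=|\mathrm{dg}(\lambda)|$ and, for a positive integer $m$, $$c_m(\lambda)=\bigl|\{x\in \mathrm{dg}(\lambda): m\,l(x)\le a(x)\le m\,l(x)+m\}\bigr|.$$ Let $\mathrm{Par}$ be the set of all integer partitions (including the empty one), and let $\mathrm{Par}_n^{(m)}$ be the set of partitions whose diagram, drawn with unit cells and with its top left corner at $(0,n)$, is contained in the triangle with vertices $(0,0)$, $(0,n)$ and $(mn,n)$. For $\lambda\in\mathrm{Par}_n^{(m)}$ put $\mathrm{area}^c(\lambda)=m\binom n2-\mathrm{area}(\lambda)$, and define $$PC_n^{(m)}(q,t)=\sum_{\lambda\in\mathrm{Par}_n^{(m)}}q^{\mathrm{area}^c(\lambda)}t^{c_m(\lambda)}\in\mathbb Z[q,t].$$ (i) For all integers $m,n\ge 1$, in $\mathbb Z[t][q,q^{-1}]$,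 $$q^{m\binom n2}PC_n^{(m)}(q^{-1},t)=\sum_{\lambda\in\mathrm{Par}_n^{(m)}}q^{\mathrm{area}(\lambda)}t^{c_m(\lambda)}.$$ (ii) For every integer $m\ge 1$, $$\lim_{n\to\infty}q^{m\binom n2}PC_n^{(m)}(q^{-1},t)=\sum_{\lambda\in\mathrm{Par}}q^{\mathrm{area}(\lambda)}t^{c_m(\lambda)}=\prod_{i=1}^{\infty}\frac1{1-tq^i},$$ where the infinite sum and product converge in the formal power series ring $\mathbb Z[[q,t]]$ (coefficientwise), and the limit means that for each fixed monomial $q^at^b$ its coefficient is, for all sufficiently large $n$, equal to the coefficient in the series on the right. -/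

import Mathlib

open scoped LaurentPolynomial MvPowerSeries.WithPiTopology

noncomputable section

namespace HigherCatalan

/-! Integer partitions are represented by their Ferrers diagrams, `YoungDiagram`: the cell `(i, j)`
is in row `i` (counted downwards from the top, rows weakly decreasing) and column `j` (counted from
the left). So `Par` is the type `YoungDiagram`, and `area` is the number of cells. -/

/-- `area λ = |λ|`, the number of cells of the diagram. -/
def area (μ : YoungDiagram) : ℕ := μ.cells.card

/-- The arm of a cell `x = (i, j)` of `μ`: the number of cells of its row strictly to its right. -/
def arm (μ : YoungDiagram) (x : ℕ × ℕ) : ℕ := μ.rowLen x.1 - (x.2 + 1)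

/-- The leg of a cell `x = (i, j)` of `μ`: the number of cells of its column strictly below it. -/
def leg (μ : YoungDiagram) (x : ℕ × ℕ) : ℕ := μ.colLen x.2 - (x.1 + 1)

/-- `c_m(λ)`, the number of cells `x` with `m l(x) ≤ a(x) ≤ m l(x) + m`. -/
def cStat (m : ℕ) (μ : YoungDiagram) : ℕ :=
  (μ.cells.filter fun x => m * leg μ x ≤ arm μ x ∧ arm μ x ≤ m * leg μ x + m).card

/-- The diagram of `μ`, drawn with its top left corner at `(0, n)`, fits in the triangle with
vertices `(0, 0)`, `(0, n)`, `(mn, n)`. The cell `(i, j)` is drawn as the unit square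
`[j, j + 1] × [n - (i + 1), n - i]`; it lies in the triangle `0 ≤ x ≤ m y`, `y ≤ n` exactly when its
lower right corner `(j + 1, n - (i + 1))` satisfies `x ≤ m y`. -/
def FitsTriangle (m n : ℕ) (μ : YoungDiagram) : Prop :=
  ∀ x ∈ μ.cells, (x.2 : ℤ) + 1 ≤ (m : ℤ) * ((n : ℤ) - ((x.1 : ℤ) + 1))

theorem FitsTriangle.lt {m n : ℕ} {μ : YoungDiagram} (h : FitsTriangle m n μ) {x : ℕ × ℕ}
    (hx : x ∈ μ.cells) : x.1 < n ∧ x.2 < m * (n - 1 - x.1) := by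
  have h1 := h x hx
  have h2 : x.1 + 1 ≤ n := by
    by_contra hc
    push Not at hc
    have : (m : ℤ) * ((n : ℤ) - ((x.1 : ℤ) + 1)) ≤ 0 :=
      mul_nonpos_of_nonneg_of_nonpos (by positivity) (by omega)
    omega
  refine ⟨h2, ?_⟩
  have h3 : ((n - 1 - x.1 : ℕ) : ℤ) = (n : ℤ) - ((x.1 : ℤ) + 1) := by omega
  have h4 : ((x.2 : ℤ)) < ((m * (n - 1 - x.1) : ℕ) : ℤ) := by
    push_cast
    rw [h3]
    omega
  exact_mod_cast h4

theorem finite_fitsTriangle (m n : ℕ) : {μ : YoungDiagram | FitsTriangle m n μ}.Finite := by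
  refine Set.Finite.of_finite_image (f := YoungDiagram.cells)
    (((Finset.range n ×ˢ Finset.range (m * n)).powerset.finite_toSet).subset ?_)
    (fun a _ b _ hab => YoungDiagram.ext hab)
  rintro _ ⟨μ, hμ, rfl⟩
  simp only [Finset.coe_powerset, Set.mem_preimage, Set.mem_powerset_iff, Finset.coe_subset]
  intro x hx
  obtain ⟨h1, h2⟩ := FitsTriangle.lt hμ hx
  have h3 : m * (n - 1 - x.1) ≤ m * n := Nat.mul_le_mul_left m (by omega)
  simp only [Finset.mem_product, Finset.mem_range]
  omega

/-- `Par_n^{(m)}`, the finite set of partitions that fit in the `mn × n` triangle. -/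
def Par (m n : ℕ) : Finset YoungDiagram := (finite_fitsTriangle m n).toFinset

/-- `area^c(λ) = m * (n choose 2) - area(λ)` (for `λ` in `Par_n^{(m)}`, where the subtraction does
not truncate by `area_le`). -/
def areaC (m n : ℕ) (μ : YoungDiagram) : ℕ := m * n.choose 2 - area μ

theorem area_le {m n : ℕ} {μ : YoungDiagram} (h : μ ∈ Par m n) : area μ ≤ m * n.choose 2 := by
  have hf : FitsTriangle m n μ := by simpa [Par] using h
  have h1 : μ.cells ⊆ ((Finset.range n).sigma fun i => Finset.range (m * (n - 1 - i))).map
      (Equiv.sigmaEquivProd ℕ ℕ).toEmbedding := by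
    intro x hx
    obtain ⟨h1, h2⟩ := hf.lt hx
    simp only [Finset.mem_map, Finset.mem_sigma, Finset.mem_range]
    exact ⟨⟨x.1, x.2⟩, ⟨h1, h2⟩, rfl⟩
  refine (Finset.card_le_card h1).trans ?_
  rw [Finset.card_map, Finset.card_sigma]
  simp only [Finset.card_range]
  rw [← Finset.mul_sum, Finset.sum_range_reflect (fun i => i) n, Finset.sum_range_id,
    Nat.choose_two_right]

/-- The partition version of the higher `q,t`-Catalan numbers,
`PC_n^{(m)}(q, t) = ∑_{λ ∈ Par_n^{(m)}} q^{area^c(λ)} t^{c_m(λ)}`, a polynomial in the two variables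
`q = X 0` and `t = X 1`. -/
def PC (m n : ℕ) : MvPolynomial (Fin 2) ℤ :=
  ∑ μ ∈ Par m n, MvPolynomial.X 0 ^ areaC m n μ * MvPolynomial.X 1 ^ cStat m μ

/-- The variable `q` of the ring `ℤ[t][q, q⁻¹]`. -/
def qL : (Polynomial ℤ)[T;T⁻¹] := LaurentPolynomial.T 1

/-- The element `q⁻¹` of the ring `ℤ[t][q, q⁻¹]`. -/
def qInvL : (Polynomial ℤ)[T;T⁻¹] := LaurentPolynomial.T (-1)

/-- The variable `t` of the ring `ℤ[t][q, q⁻¹]`. -/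
def tL : (Polynomial ℤ)[T;T⁻¹] := LaurentPolynomial.C Polynomial.X

/-- The modified higher `q,t`-Catalan number `q^{m (n choose 2)} PC_n^{(m)}(q⁻¹, t)`, computed in
`ℤ[t][q, q⁻¹]`. -/
def modifiedPC (m n : ℕ) : (Polynomial ℤ)[T;T⁻¹] :=
  qL ^ (m * n.choose 2) * MvPolynomial.aeval ![qInvL, tL] (PC m n)

/-- The formal power series ring `ℤ[[q, t]]`; its topology is that of coefficientwise convergence
(with `ℤ` discrete). -/
abbrev Series : Type := MvPowerSeries (Fin 2) ℤ

/-- The variable `q` of `ℤ[[q, t]]`. -/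
def qS : Series := MvPowerSeries.X 0

/-- The variable `t` of `ℤ[[q, t]]`. -/
def tS : Series := MvPowerSeries.X 1

/-- A sequence in `ℤ[t][q, q⁻¹]` has the formal power series `S ∈ ℤ[[q, t]]` as its limit: for large
`n` no negative power of `q` occurs, and for each monomial `q^a t^b` its coefficient is, for all
sufficiently large `n`, equal to the coefficient in `S`. -/
def HasFormalLimit (L : ℕ → (Polynomial ℤ)[T;T⁻¹]) (S : Series) : Prop :=
  (∀ᶠ n in Filter.atTop, ∀ k : ℤ, k < 0 → (L n).coeff k = 0) ∧
  ∀ a b : ℕ, ∀ᶠ n in Filter.atTop,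
    ((L n).coeff (a : ℤ)).coeff b =
      MvPowerSeries.coeff (Finsupp.single 0 a + Finsupp.single 1 b) S

/-- The formal power series `1 / (1 - t q^i)` (for `i ≥ 1`), the inverse of `1 - t q^i`, whose
constant coefficient is `1`. -/
def geomFactor (i : ℕ) : Series := MvPowerSeries.invOfUnit (1 - tS * qS ^ i) 1

end HigherCatalan

end

/-!
Part (i) is a rewriting of the definition, and a partition of size `a` fits in all triangles with
`n > a`, so the limit in part (ii) is the generating function of all partitions. The content is
that `c_m` has the same distribution on the partitions of a given size `N` as the number of parts
(`card_cStat_eq_card_colLen`), whose generating function is the product: removing a largest part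
`n` gives `(1 - t q ^ n) G_n = G_(n - 1)` for the partitions with parts at most `n`
(`boundedSeries_succ`).

For a slope `x` consider the cells with `a / (l + 1) ≤ x < (a + 1) / l` (`hPlus`) and those with
`a / (l + 1) < x ≤ (a + 1) / l` (`hMinus`), where `a` is the arm and `l` the leg, and the upper
bounds are void for `l = 0`. The first kind is counted by `c_m` for `x = m`, and by the number of
parts for `x = 0`. The number of cells of the first kind at `x = j / N!` is the
number of cells of the second kind at `x = (j + 1) / N!`, so it is enough to show that for a slope
`x = r / s` the two numbers have the same distribution (`sum_hPlus_eq_sum_hMinus`).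

Walk along the boundary of the partition in a box with `s N` rows and `r N` columns, going up by `r`
for each row and down by `s` for each column. This is a closed walk on `ℤ`, and a cell is a pair of
an upward step and a later downward step. If `d` is the difference of their start levels, then the cells of
the two kinds are those with `0 ≤ d < r + s` and with `0 < d ≤ r + s`. The multisets of the start
levels of the upward and of the downward steps determine the area and the number of cells with
`0 < d < r + s`, by a telescoping sum (`two_mul_pairSum`). What remains are the cells with `d = 0`,
the inversions in the sequences of departures from each level, and those with `d = r + s`, the
inversions in the sequences of arrivals. The walks with given start levels are the Eulerian tours of
a multigraph. Counted by inversions of departures, they are given by a product of `t`-factorials and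
a weighted Laplacian determinant (`tourSum_eq`), a `t`-analogue of the BEST theorem. Reversing the
walk turns arrivals into departures and the matrix into one that is conjugate, by a diagonal
matrix, to its transpose (`det_lap_rev`), so both distributions agree.
-/

namespace HigherCatalan

/-! ### Boundary words and the pairs that stand for cells -/

/-- A partition is encoded by its boundary, read from the top right to the bottom left corner of a
box: `true` is the step down along a row, `false` the step to the left along a column. The word is
walked on levels in `ℤ`: starting from level `a`, a `true` raises the level by `r` and a `false`
lowers it by `s`. `vStarts r s w a` is the multiset of the levels from which the `true` steps
start. -/
def vStarts (r s : ℤ) : List Bool → ℤ → Multiset ℤ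
  | [], _ => 0
  | true :: w, a => a ::ₘ vStarts r s w (a + r)
  | false :: w, a => vStarts r s w (a - s)

/-- The multiset of the levels from which the `false` steps of the walk start. -/
def hStarts (r s : ℤ) : List Bool → ℤ → Multiset ℤ
  | [], _ => 0
  | true :: w, a => hStarts r s w (a + r)
  | false :: w, a => a ::ₘ hStarts r s w (a - s)

/-- The level at which the walk ends. -/
def endLevel (r s : ℤ) : List Bool → ℤ → ℤ
  | [], a => a
  | true :: w, a => endLevel r s w (a + r)
  | false :: w, a => endLevel r s w (a - s)

/-- The sum of `φ d` over all pairs of a `true` and a later `false` (these pairs are the cells of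
the partition), where `d` is the start level of the `false` minus the start level of the `true`. -/
def pairSum (r s : ℤ) (φ : ℤ → ℕ) : List Bool → ℤ → ℕ
  | [], _ => 0
  | true :: w, a => ((hStarts r s w (a + r)).map fun f => φ (f - a)).sum + pairSum r s φ w (a + r)
  | false :: w, a => pairSum r s φ w (a - s)

theorem pairSum_add (r s : ℤ) (φ ψ : ℤ → ℕ) (w : List Bool) (a : ℤ) :
    pairSum r s (fun d => φ d + ψ d) w a = pairSum r s φ w a + pairSum r s ψ w a := by
  induction w generalizing a with
  | nil => simp [pairSum]
  | cons x w ih =>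
    cases x <;> simp only [pairSum, ih, Multiset.sum_map_add]
    ring

theorem card_vStarts (r s : ℤ) (w : List Bool) (a : ℤ) :
    Multiset.card (vStarts r s w a) = w.count true := by
  induction w generalizing a with
  | nil => simp [vStarts]
  | cons x w ih => cases x <;> simp [vStarts, ih]

theorem card_hStarts (r s : ℤ) (w : List Bool) (a : ℤ) :
    Multiset.card (hStarts r s w a) = w.count false := by
  induction w generalizing a with
  | nil => simp [hStarts]
  | cons x w ih => cases x <;> simp [hStarts, ih]

theorem endLevel_eq (r s : ℤ) (w : List Bool) (a : ℤ) :
    endLevel r s w a = a + r * w.count true - s * w.count false := by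
  induction w generalizing a with
  | nil => simp [endLevel]
  | cons x w ih => cases x <;> simp [endLevel, ih] <;> ring

/-- Every visit of a level `k`, except the initial and the final one, has an arrival and a
departure. -/
theorem count_starts_balance (r s : ℤ) (w : List Bool) (a k : ℤ) :
    (vStarts r s w a).count k + (hStarts r s w a).count k + (if k = endLevel r s w a then 1 else 0)
      = (vStarts r s w a).count (k - r) + (hStarts r s w a).count (k + s)
        + (if k = a then 1 else 0) := by
  induction w generalizing a with
  | nil => exact rfl
  | cons x w ih =>
    cases x
    · have := ih (a - s)
      have e : k + s = a ↔ k = a - s := by omega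
      change (vStarts r s w (a - s)).count k + (a ::ₘ hStarts r s w (a - s)).count k
        + (if k = endLevel r s w (a - s) then 1 else 0) = (vStarts r s w (a - s)).count (k - r)
        + (a ::ₘ hStarts r s w (a - s)).count (k + s) + _
      simp only [Multiset.count_cons, e]
      omega
    · have := ih (a + r)
      have e : k - r = a ↔ k = a + r := by omega
      change (a ::ₘ vStarts r s w (a + r)).count k + (hStarts r s w (a + r)).count k
        + (if k = endLevel r s w (a + r) then 1 else 0)
        = (a ::ₘ vStarts r s w (a + r)).count (k - r) + (hStarts r s w (a + r)).count (k + s) + _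
      simp only [Multiset.count_cons, e]
      omega

theorem sum_starts_telescope (r s : ℤ) (w : List Bool) (a : ℤ) (G : ℤ → ℤ) :
    ((vStarts r s w a).map fun e => G (e + r) - G e).sum
      + ((hStarts r s w a).map fun f => G (f - s) - G f).sum = G (endLevel r s w a) - G a := by
  induction w generalizing a with
  | nil => simp [vStarts, hStarts, endLevel]
  | cons x w ih =>
    cases x
    · have := ih (a - s)
      simp only [vStarts, hStarts, endLevel, Multiset.map_cons, Multiset.sum_cons]
      omega
    · have := ih (a + r)
      simp only [vStarts, hStarts, endLevel, Multiset.map_cons, Multiset.sum_cons]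
      omega

/-- For an odd function `F`, the difference of the sums of `F d - F (d - r - s)` over the pairs
`true … false` and over the pairs `false … true` telescopes, and the sum of both runs over all
pairs, whatever their order. Hence each of them is determined by the start levels. -/
theorem two_mul_pairSum (r s : ℤ) (F : ℤ → ℤ) (hF : ∀ d, F (-d) = -F d) (c : ℤ) (φ : ℤ → ℕ)
    (hφ : ∀ d, c * (φ d : ℤ) = F d - F (d - r - s)) (w : List Bool) (a : ℤ) :
    2 * (c * (pairSum r s φ w a : ℤ)) =
      ((vStarts r s w a).map fun e =>
        ((hStarts r s w a).map fun f => c * (φ (f - e) : ℤ)).sum).sum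
      + ((vStarts r s w a).map fun e => F (e - a) - F (endLevel r s w a - e - r)).sum
      + ((hStarts r s w a).map fun f => F (f - a) - F (endLevel r s w a - f + s)).sum := by
  induction w generalizing a with
  | nil => simp [pairSum, vStarts, hStarts]
  | cons x w ih =>
    cases x
    · have h1 := ih (a - s)
      have h2 := sum_starts_telescope r s w (a - s) (fun x => F (x - (a - s)))
      simp only [pairSum, vStarts, hStarts, endLevel, Multiset.map_cons, Multiset.sum_cons,
        Multiset.sum_map_add, Multiset.sum_map_sub, hφ] at h1 h2 ⊢
      have e1 : ∀ e, F (a - e) = - F (e - a) := fun e => by rw [← hF]; ring_nf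
      have e2 : ∀ e, F (a - e - r - s) = - F (e + r - (a - s)) := fun e => by rw [← hF]; ring_nf
      have e3 : ∀ f, F (f - s - (a - s)) = F (f - a) := fun e => by ring_nf
      have e4 : F (endLevel r s w (a - s) - a + s) = F (endLevel r s w (a - s) - (a - s)) := by
        ring_nf
      simp only [e1, e2, e3, e4, sub_self, Multiset.sum_map_neg] at h1 h2 ⊢
      linarith
    · have h1 := ih (a + r)
      have h2 := sum_starts_telescope r s w (a + r) (fun x => F (x - (a + r)))
      have hc : c * (((hStarts r s w (a + r)).map fun f => φ (f - a)).sum : ℕ)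
          = ((hStarts r s w (a + r)).map fun f => F (f - a) - F (f - a - r - s)).sum := by
        rw [Nat.cast_multiset_sum, Multiset.map_map, ← Multiset.sum_map_mul_left]
        simp only [Function.comp_apply, hφ]
      simp only [pairSum, vStarts, hStarts, endLevel, Multiset.map_cons, Multiset.sum_cons,
        Multiset.sum_map_sub, hφ, Nat.cast_add, mul_add] at h1 h2 hc ⊢
      have e1 : ∀ e, F (e + r - (a + r)) = F (e - a) := fun e => by ring_nf
      have e2 : ∀ f, F (f - s - (a + r)) = F (f - a - r - s) := fun e => by ring_nf
      have e4 : F (endLevel r s w (a + r) - a - r) = F (endLevel r s w (a + r) - (a + r)) := by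
        ring_nf
      simp only [e1, e2, e4, sub_self, hc] at h1 h2 ⊢
      linarith

theorem pairSum_congr_of_odd {r s : ℤ} {F : ℤ → ℤ} (hF : ∀ d, F (-d) = -F d) {c : ℤ} (hc : c ≠ 0)
    {φ : ℤ → ℕ} (hφ : ∀ d, c * (φ d : ℤ) = F d - F (d - r - s)) {w w' : List Bool} {a : ℤ}
    (hv : vStarts r s w a = vStarts r s w' a) (hh : hStarts r s w a = hStarts r s w' a) :
    pairSum r s φ w a = pairSum r s φ w' a := by
  have he : endLevel r s w a = endLevel r s w' a := by
    rw [endLevel_eq, endLevel_eq, ← card_vStarts r s w a, ← card_hStarts r s w a, hv, hh,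
      card_vStarts, card_hStarts]
  have h1 := two_mul_pairSum r s F hF c φ hφ w a
  rw [hv, hh, he, ← two_mul_pairSum r s F hF c φ hφ w' a] at h1
  have := mul_left_cancel₀ hc (mul_left_cancel₀ two_ne_zero h1)
  exact_mod_cast this

/-- The number of pairs (the area of the partition) is determined by the start levels. -/
theorem pairSum_one_congr {r s : ℤ} (hr : 0 < r) (hs : 0 < s) {w w' : List Bool} {a : ℤ}
    (hv : vStarts r s w a = vStarts r s w' a) (hh : hStarts r s w a = hStarts r s w' a) :
    pairSum r s (fun _ => 1) w a = pairSum r s (fun _ => 1) w' a :=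
  pairSum_congr_of_odd (F := fun d => d) (c := r + s) (fun _ => rfl) (by omega)
    (fun d => by push_cast; ring) hv hh

/-- The number of pairs with `0 < d < r + s` is determined by the start levels. -/
theorem pairSum_mid_congr {r s : ℤ} (hr : 0 < r) (hs : 0 < s) {w w' : List Bool} {a : ℤ}
    (hv : vStarts r s w a = vStarts r s w' a) (hh : hStarts r s w a = hStarts r s w' a) :
    pairSum r s (fun d => if 0 < d ∧ d < r + s then 1 else 0) w a
      = pairSum r s (fun d => if 0 < d ∧ d < r + s then 1 else 0) w' a := by
  -- The sign function, made to vanish on the multiples of `r + s`.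
  refine pairSum_congr_of_odd (F := fun d => if r + s ∣ d then 0 else d.sign) (c := 2) (fun d => ?_)
    two_ne_zero (fun d => ?_) hv hh
  · simp only [dvd_neg, Int.sign_neg]
    split_ifs <;> simp
  · have hd : r + s ∣ d - r - s ↔ r + s ∣ d := by
      rw [show d - r - s = d - (r + s) by ring, dvd_sub_self_right]
    simp only [hd]
    by_cases h : r + s ∣ d
    · have : ¬ (0 < d ∧ d < r + s) := fun h' => by
        have := Int.le_of_dvd h'.1 h
        omega
      simp [h, this]
    · have h0 : d ≠ 0 := by rintro rfl; simp at h
      have h1 : d ≠ r + s := by rintro rfl; simp at h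
      simp only [h, if_false]
      rcases lt_trichotomy d 0 with h2 | h2 | h2
      · rw [Int.sign_eq_neg_one_of_neg h2, Int.sign_eq_neg_one_of_neg (by omega), if_neg (by omega)]
        simp
      · exact absurd h2 h0
      · rw [Int.sign_eq_one_of_pos h2]
        by_cases h3 : d < r + s
        · rw [Int.sign_eq_neg_one_of_neg (by omega), if_pos ⟨h2, h3⟩]
          norm_num
        · rw [Int.sign_eq_one_of_pos (by omega), if_neg (by omega)]
          simp

/-! ### Counting words with prescribed start levels by a determinant -/

/-- The finite set of the words of length `n`. -/
def words : ℕ → Finset (List Bool)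
  | 0 => {[]}
  | n + 1 => (words n).image (List.cons true) ∪ (words n).image (List.cons false)

theorem mem_words {n : ℕ} {w : List Bool} : w ∈ words n ↔ w.length = n := by
  induction n generalizing w with
  | zero => simp [words]
  | succ n ih =>
    cases w with
    | nil => simp [words]
    | cons x w => cases x <;> simp [words, ih]

theorem sum_words_succ {M : Type*} [AddCommMonoid M] (n : ℕ) (F : List Bool → M) :
    ∑ w ∈ words (n + 1), F w = ∑ w ∈ words n, F (true :: w) + ∑ w ∈ words n, F (false :: w) := by
  rw [words, Finset.sum_union, Finset.sum_image, Finset.sum_image]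
  · simp
  · simp
  · rw [Finset.disjoint_left]
    simp

/-- The `t`-analogue `1 + t + ⋯ + t ^ (n - 1)` of the number `n`. -/
def qInt (t : ℝ) (n : ℕ) : ℝ := ∑ i ∈ Finset.range n, t ^ i

/-- The `t`-analogue of the factorial of `n`. -/
def qFact (t : ℝ) (n : ℕ) : ℝ := ∏ i ∈ Finset.range n, qInt t (i + 1)

@[simp] theorem qInt_zero (t : ℝ) : qInt t 0 = 0 := by simp [qInt]

@[simp] theorem qInt_one (t : ℝ) : qInt t 1 = 1 := by simp [qInt]

@[simp] theorem qFact_zero (t : ℝ) : qFact t 0 = 1 := by simp [qFact]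

theorem qFact_succ (t : ℝ) (n : ℕ) : qFact t (n + 1) = qFact t n * qInt t (n + 1) := by
  simp [qFact, Finset.prod_range_succ]

theorem qInt_add (t : ℝ) (m n : ℕ) : qInt t (m + n) = qInt t m + t ^ m * qInt t n := by
  simp only [qInt, Finset.sum_range_add, pow_add, Finset.mul_sum]

theorem qInt_pos {t : ℝ} (ht : 0 < t) (n : ℕ) : 0 < qInt t (n + 1) :=
  Finset.sum_pos (fun _ _ => by positivity) ⟨0, by simp⟩

theorem qFact_pos {t : ℝ} (ht : 0 < t) (n : ℕ) : 0 < qFact t n :=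
  Finset.prod_pos fun i _ => qInt_pos ht i

/-- The generating function, by the number of pairs with `d = 0` (that is, of inversions in the
sequences of departures from each level), of the words of length `n` whose walk from level `a` has
the start levels `v` and `h`. -/
def tourSum (r s : ℤ) (t : ℝ) (n : ℕ) (v h : Multiset ℤ) (a : ℤ) : ℝ :=
  ∑ w ∈ words n, if vStarts r s w a = v ∧ hStarts r s w a = h then
    t ^ pairSum r s (fun d => if d = 0 then 1 else 0) w a else 0

theorem cons_eq_iff_mem_and_eq_erase {a : ℤ} {m v : Multiset ℤ} :
    a ::ₘ m = v ↔ a ∈ v ∧ m = v.erase a := by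
  constructor
  · rintro rfl
    simp
  · rintro ⟨h, rfl⟩
    exact Multiset.cons_erase h

theorem sum_indicator_eq_count (m : Multiset ℤ) (a c : ℤ) :
    (m.map fun f => if f - a = c then 1 else 0).sum = m.count (a + c) := by
  induction m using Multiset.induction_on with
  | empty => simp
  | cons x m ih =>
    have e : x - a = c ↔ a + c = x := by omega
    simp only [Multiset.map_cons, Multiset.sum_cons, ih, Multiset.count_cons, e]
    ring

/-- The recursion for `tourSum` given by the first step. -/
theorem tourSum_succ (r s : ℤ) (t : ℝ) (n : ℕ) (v h : Multiset ℤ) (a : ℤ) :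
    tourSum r s t (n + 1) v h a =
      (if a ∈ v then t ^ h.count a * tourSum r s t n (v.erase a) h (a + r) else 0)
      + (if a ∈ h then tourSum r s t n v (h.erase a) (a - s) else 0) := by
  rw [tourSum, sum_words_succ]
  congr 1
  · simp only [vStarts, hStarts, pairSum, cons_eq_iff_mem_and_eq_erase]
    split_ifs with ha
    · rw [tourSum, Finset.mul_sum]
      refine Finset.sum_congr rfl fun w _ => ?_
      simp only [ha, true_and]
      split_ifs with hw
      · rw [hw.2, sum_indicator_eq_count, add_zero, pow_add]
      · simp
    · simp [ha]
  · simp only [vStarts, hStarts, pairSum, cons_eq_iff_mem_and_eq_erase]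
    split_ifs with ha
    · simp [ha, tourSum]
    · simp [ha]

/-- The condition on start levels for a walk from `a` to `b`: every visit of a level, except the
initial and the final one, has an arrival and a departure. -/
def Balanced (r s a b : ℤ) (v h : Multiset ℤ) : Prop :=
  ∀ k, v.count k + h.count k + (if k = b then 1 else 0)
    = v.count (k - r) + h.count (k + s) + (if k = a then 1 else 0)

theorem Balanced.erase_v {r s a b : ℤ} {v h : Multiset ℤ} (hb : Balanced r s a b v h)
    (ha : a ∈ v) : Balanced r s (a + r) b (v.erase a) h := by
  obtain ⟨m, rfl⟩ := Multiset.exists_cons_of_mem ha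
  intro k
  have := hb k
  have e : k - r = a ↔ k = a + r := by omega
  simp only [Multiset.count_cons, e] at this
  simp only [Multiset.erase_cons_head]
  omega

theorem Balanced.erase_h {r s a b : ℤ} {v h : Multiset ℤ} (hb : Balanced r s a b v h)
    (ha : a ∈ h) : Balanced r s (a - s) b v (h.erase a) := by
  obtain ⟨m, rfl⟩ := Multiset.exists_cons_of_mem ha
  intro k
  have := hb k
  have e : k + s = a ↔ k = a - s := by omega
  simp only [Multiset.count_cons, e] at this
  simp only [Multiset.erase_cons_head]
  omega

/-- A row of the Laplacian matrix of the graph of start levels, for a level `i` with `x` departures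
upwards and `y` departures downwards. A level that is not visited has the row of the identity
matrix. -/
def lapRow (r s : ℤ) (t : ℝ) (W : Finset ℤ) (i : ℤ) (x y : ℕ) : W → ℝ := fun j =>
  (if (j : ℤ) = i then (if x + y = 0 then 1 else qInt t (x + y)) else 0)
    - (if (j : ℤ) = i + r then qInt t x else 0)
    - (if (j : ℤ) = i - s then t ^ x * qInt t y else 0)

/-- The Laplacian matrix of the graph of start levels `v` and `h`, in which an edge upwards from
`i` has the weight `[v_i]` in total and an edge downwards the weight `t ^ v_i [h_i]`; the rows and
columns are restricted to `W`, which omits the final level. -/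
def lap (r s : ℤ) (t : ℝ) (W : Finset ℤ) (v h : Multiset ℤ) : Matrix W W ℝ :=
  Matrix.of fun i => lapRow r s t W i (v.count (i : ℤ)) (h.count (i : ℤ))

/-- The factor `[x + y - 1]! / ([x]! [y]!)` of a level with `x` departures upwards and `y`
departures downwards, of which the last one is prescribed. For `x = y = 0` it is `1`. -/
noncomputable def levelFactor (t : ℝ) (x y : ℕ) : ℝ := qFact t (x + y - 1) / (qFact t x * qFact t y)

/-- The `t`-binomial coefficient, the factor of the final level. -/
noncomputable def finalFactor (t : ℝ) (x y : ℕ) : ℝ := qFact t (x + y) / (qFact t x * qFact t y)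

theorem lapRow_eq (r s : ℤ) (t : ℝ) (W : Finset ℤ) (i : ℤ) {x y : ℕ} (hxy : x + y ≠ 0) :
    lapRow r s t W i x y =
      qInt t x • (fun j : W => (if (j : ℤ) = i then 1 else 0) - (if (j : ℤ) = i + r then 1 else 0))
      + (t ^ x * qInt t y) •
        (fun j : W => (if (j : ℤ) = i then 1 else 0) - (if (j : ℤ) = i - s then 1 else 0)) := by
  funext j
  simp only [lapRow, hxy, if_false, Pi.add_apply, Pi.smul_apply, smul_eq_mul, qInt_add]
  split_ifs <;> ring

theorem det_updateRow_lapRow (r s : ℤ) (t : ℝ) (W : Finset ℤ) (M : Matrix W W ℝ) (a : W) {x y : ℕ}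
    (hxy : x + y ≠ 0) :
    (M.updateRow a (lapRow r s t W a x y)).det =
      qInt t x * (M.updateRow a fun j : W =>
        (if (j : ℤ) = a then 1 else 0) - (if (j : ℤ) = a + r then 1 else 0)).det
      + t ^ x * qInt t y * (M.updateRow a fun j : W =>
        (if (j : ℤ) = a then 1 else 0) - (if (j : ℤ) = a - s then 1 else 0)).det := by
  rw [lapRow_eq r s t W a hxy, Matrix.det_updateRow_add, Matrix.det_updateRow_smul,
    Matrix.det_updateRow_smul]

/-- Two forms of the `t`-Pascal rule, one for each of the coefficients `A` and `B`. -/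
theorem levelFactor_recursion {t : ℝ} (ht : 0 < t) (A B : ℝ) {x y : ℕ} (hxy : 2 ≤ x + y) :
    levelFactor t x y * (qInt t x * A + t ^ x * qInt t y * B) =
      (if 0 < x then t ^ y * (levelFactor t (x - 1) y *
        (qInt t (x - 1) * A + t ^ (x - 1) * qInt t y * B)) else 0)
      + (if 0 < y then levelFactor t x (y - 1) *
        (qInt t x * A + t ^ x * qInt t (y - 1) * B) else 0) := by
  rcases x with _ | x <;> rcases y with _ | y
  · omega
  · obtain ⟨y, rfl⟩ : ∃ z, y = z + 1 := ⟨y - 1, by omega⟩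
    have h1 := (qFact_pos ht y).ne'
    have h2 := (qInt_pos ht y).ne'
    have h3 := (qInt_pos ht (y + 1)).ne'
    simp [levelFactor, qFact_succ]
    field_simp
  · obtain ⟨x, rfl⟩ : ∃ z, x = z + 1 := ⟨x - 1, by omega⟩
    have h1 := (qFact_pos ht x).ne'
    have h2 := (qInt_pos ht x).ne'
    have h3 := (qInt_pos ht (x + 1)).ne'
    simp [levelFactor, qFact_succ]
    field_simp
  · have hx := (qFact_pos ht x).ne'
    have hy := (qFact_pos ht y).ne'
    have hx' := (qInt_pos ht x).ne'
    have hy' := (qInt_pos ht y).ne'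
    have e1 : qInt t (x + y + 1) = qInt t (y + 1) + t ^ (y + 1) * qInt t x := by
      rw [← qInt_add]; ring_nf
    have e2 : qInt t (x + y + 1) = qInt t y + t ^ y * qInt t (x + 1) := by
      rw [← qInt_add]; ring_nf
    have e3 : x + 1 + (y + 1) - 1 = x + y + 1 := by omega
    have e4 : x + (y + 1) - 1 = x + y := by omega
    have e5 : x + 1 + y - 1 = x + y := by omega
    simp only [levelFactor, Nat.add_sub_cancel, e3, e4, e5, Nat.succ_pos, if_true, qFact_succ]
    field_simp
    linear_combination qFact t (x + y) * A * qInt t (x + 1) * e1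
      + qFact t (x + y) * B * t ^ (x + 1) * qInt t (y + 1) * e2

theorem finalFactor_recursion {t : ℝ} (ht : 0 < t) {x y : ℕ} (hxy : 1 ≤ x + y) :
    finalFactor t x y =
      (if 0 < x then t ^ y * finalFactor t (x - 1) y else 0)
      + (if 0 < y then finalFactor t x (y - 1) else 0) := by
  rcases x with _ | x <;> rcases y with _ | y
  · omega
  · have h1 := (qFact_pos ht y).ne'
    have h2 := (qInt_pos ht y).ne'
    simp [finalFactor, qFact_succ]
    field_simp
  · have h1 := (qFact_pos ht x).ne'
    have h2 := (qInt_pos ht x).ne'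
    simp [finalFactor, qFact_succ]
    field_simp
  · have hx := (qFact_pos ht x).ne'
    have hy := (qFact_pos ht y).ne'
    have hx' := (qInt_pos ht x).ne'
    have hy' := (qInt_pos ht y).ne'
    have e1 : qInt t (x + y + 1 + 1) = qInt t (y + 1) + t ^ (y + 1) * qInt t (x + 1) := by
      rw [← qInt_add]; ring_nf
    have e3 : x + 1 + (y + 1) = x + y + 1 + 1 := by omega
    have e4 : x + (y + 1) = x + y + 1 := by omega
    have e5 : x + 1 + y = x + y + 1 := by omega
    simp only [finalFactor, Nat.add_sub_cancel, e3, e4, e5, Nat.succ_pos, if_true, qFact_succ]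
    field_simp
    linear_combination qFact t (x + y) * qInt t (x + y + 1) * e1

theorem lap_erase_v (r s : ℤ) (t : ℝ) (W : Finset ℤ) (v h : Multiset ℤ) (a : W) :
    lap r s t W (v.erase a) h = (lap r s t W v h).updateRow a
      (lapRow r s t W a (v.count (a : ℤ) - 1) (h.count (a : ℤ))) := by
  ext i j
  by_cases hi : i = a
  · subst hi
    simp [lap, Multiset.count_erase_self]
  · have : (i : ℤ) ≠ a := fun e => hi (Subtype.ext e)
    simp [lap, hi, Multiset.count_erase_of_ne this]

theorem lap_erase_h (r s : ℤ) (t : ℝ) (W : Finset ℤ) (v h : Multiset ℤ) (a : W) :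
    lap r s t W v (h.erase a) = (lap r s t W v h).updateRow a
      (lapRow r s t W a (v.count (a : ℤ)) (h.count (a : ℤ) - 1)) := by
  ext i j
  by_cases hi : i = a
  · subst hi
    simp [lap, Multiset.count_erase_self]
  · have : (i : ℤ) ≠ a := fun e => hi (Subtype.ext e)
    simp [lap, hi, Multiset.count_erase_of_ne this]

/-- Erasing a level outside `W` does not change the matrix. -/
theorem lap_congr (r s : ℤ) (t : ℝ) {W : Finset ℤ} {v h v' h' : Multiset ℤ}
    (hv : ∀ k ∈ W, v.count k = v'.count k) (hh : ∀ k ∈ W, h.count k = h'.count k) :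
    lap r s t W v h = lap r s t W v' h' := by
  ext i j
  simp only [lap, Matrix.of_apply, hv i i.2, hh i i.2]

/-- If the walk visits some levels, but not the final one, then the Laplacian matrix is singular:
its visited part has vanishing row sums. -/
theorem det_lap_eq_zero {r s : ℤ} {t : ℝ} {W : Finset ℤ} {v h : Multiset ℤ} {b : ℤ}
    (hbal : Balanced r s b b v h)
    (hW : ∀ k, v.count k + h.count k ≠ 0 → k ∈ W)
    (hne : ∃ k, v.count k + h.count k ≠ 0) : (lap r s t W v h).det = 0 := by
  rw [← Matrix.exists_mulVec_eq_zero_iff]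
  obtain ⟨k, hk⟩ := hne
  refine ⟨fun j => if v.count (j : ℤ) + h.count (j : ℤ) = 0 then 0 else 1, fun h0 => ?_, ?_⟩
  · have := congrFun h0 ⟨k, hW k hk⟩
    simp only [hk, if_false, Pi.zero_apply] at this
    exact one_ne_zero this
  have key : ∀ (c : ℤ) (x : ℝ), (c ∉ W → x = 0) → (v.count c + h.count c = 0 → x = 0) →
      ∑ j : W, (if (j : ℤ) = c then x else 0) *
        (if v.count (j : ℤ) + h.count (j : ℤ) = 0 then 0 else 1) = x := by
    intro c x h1 h2
    rw [Finset.sum_coe_sort W fun j : ℤ => (if j = c then x else 0) *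
        (if v.count j + h.count j = 0 then 0 else 1)]
    by_cases hc : c ∈ W
    · rw [Finset.sum_eq_single_of_mem c hc fun j _ hj => by simp [hj]]
      by_cases h3 : v.count c + h.count c = 0
      · simp [h2 h3]
      · simp only [if_true, h3, if_false, mul_one]
    · rw [Finset.sum_eq_zero fun j hj => ?_, h1 hc]
      have : j ≠ c := fun e => hc (e ▸ hj)
      simp [this]
  funext i
  simp only [Matrix.mulVec, dotProduct, lap, Matrix.of_apply, lapRow, Pi.zero_apply, sub_mul,
    Finset.sum_sub_distrib]
  by_cases hi : v.count (i : ℤ) + h.count (i : ℤ) = 0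
  · rw [Finset.sum_eq_zero, Finset.sum_eq_zero, Finset.sum_eq_zero]
    · simp
    · intro j _
      have : h.count (i : ℤ) = 0 := by omega
      simp [this]
    · intro j _
      have : v.count (i : ℤ) = 0 := by omega
      simp [this]
    · intro j _
      by_cases hj : (j : ℤ) = i
      · simp [hj, hi]
      · simp [hj]
  · have hv : v.count (i : ℤ) ≠ 0 → v.count ((i : ℤ) + r) + h.count ((i : ℤ) + r) ≠ 0 := by
      intro h1
      have := hbal (i + r)
      rw [add_sub_cancel_right] at this
      omega
    have hh : h.count (i : ℤ) ≠ 0 → v.count ((i : ℤ) - s) + h.count ((i : ℤ) - s) ≠ 0 := by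
      intro h1
      have := hbal (i - s)
      rw [sub_add_cancel] at this
      omega
    rw [key, key, key]
    · rw [if_neg hi, qInt_add]
      ring
    · intro h1
      have : h.count (i : ℤ) = 0 := by
        by_contra h2
        exact h1 (hW _ (hh h2))
      simp [this]
    · intro h1
      have : h.count (i : ℤ) = 0 := by
        by_contra h2
        exact hh h2 h1
      simp [this]
    · intro h1
      have : v.count (i : ℤ) = 0 := by
        by_contra h2
        exact h1 (hW _ (hv h2))
      simp [this]
    · intro h1
      have : v.count (i : ℤ) = 0 := by
        by_contra h2
        exact hv h2 h1
      simp [this]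
    · exact fun h1 => absurd i.2 h1
    · exact fun h1 => absurd h1 hi

/-- If the column of `a` vanishes outside its diagonal entry, then the part of the row of `a`
outside the diagonal is irrelevant. -/
theorem det_updateRow_of_column_eq_zero {W : Finset ℤ} (M : Matrix W W ℝ) (a : W)
    (hM : ∀ i, i ≠ a → M i a = 0) {c : ℤ} (hc : c ≠ a) :
    (M.updateRow a fun j : W => (if (j : ℤ) = a then 1 else 0) - (if (j : ℤ) = c then 1 else 0)).det
      = (M.updateRow a fun j : W => if (j : ℤ) = a then 1 else 0).det := by
  have h0 : (M.updateRow a fun j : W => if (j : ℤ) = c then 1 else 0).det = 0 := by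
    refine Matrix.det_eq_zero_of_column_eq_zero a fun i => ?_
    by_cases hi : i = a
    · subst hi
      simp [hc.symm]
    · simp [hi, hM i hi]
  have h1 := Matrix.det_updateRow_add M a
    (fun j : W => (if (j : ℤ) = a then 1 else 0) - (if (j : ℤ) = c then 1 else 0))
    (fun j : W => if (j : ℤ) = c then 1 else 0)
  rw [h0, add_zero] at h1
  rw [← h1]
  congr 2
  funext j
  simp

theorem lap_updateRow_self (r s : ℤ) (t : ℝ) (W : Finset ℤ) (v h : Multiset ℤ) (a : W) :
    (lap r s t W v h).updateRow a (lapRow r s t W a (v.count (a : ℤ)) (h.count (a : ℤ)))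
      = lap r s t W v h :=
  Matrix.updateRow_eq_self _ _

theorem prod_levelFactor_erase {t : ℝ} {W : Finset ℤ} {a : ℤ} (ha : a ∈ W) (v h v' h' : Multiset ℤ)
    (hv : ∀ k, k ≠ a → v'.count k = v.count k) (hh : ∀ k, k ≠ a → h'.count k = h.count k) :
    ∏ k ∈ W, levelFactor t (v'.count k) (h'.count k) =
      levelFactor t (v'.count a) (h'.count a)
        * ∏ k ∈ W.erase a, levelFactor t (v.count k) (h.count k) := by
  rw [← Finset.mul_prod_erase W _ ha]
  congr 1
  refine Finset.prod_congr rfl fun k hk => ?_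
  rw [hv k (Finset.ne_of_mem_erase hk), hh k (Finset.ne_of_mem_erase hk)]

/-- The generating function of the walks from `a` to `b` with given start levels is a product of
`t`-factorials times a Laplacian determinant. For `t = 1` this is the count of Eulerian tours by
the BEST theorem together with the matrix tree theorem; here it is verified by checking that the
right-hand side satisfies the recursion `tourSum_succ`. -/
theorem tourSum_eq {r s : ℤ} (hr : r ≠ 0) (hs : s ≠ 0) {t : ℝ} (ht : 0 < t) {W : Finset ℤ} {b : ℤ}
    (hbW : b ∉ W) (n : ℕ) (v h : Multiset ℤ) (a : ℤ) (hbal : Balanced r s a b v h)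
    (hW : ∀ k, v.count k + h.count k ≠ 0 → k ∈ W ∨ k = b)
    (hn : Multiset.card v + Multiset.card h = n) :
    tourSum r s t n v h a = finalFactor t (v.count b) (h.count b)
      * (∏ k ∈ W, levelFactor t (v.count k) (h.count k)) * (lap r s t W v h).det := by
  induction n generalizing v h a with
  | zero =>
    have hv : v = 0 := Multiset.card_eq_zero.1 (by omega)
    have hh : h = 0 := Multiset.card_eq_zero.1 (by omega)
    subst hv hh
    have hab : b = a := by
      by_contra hne
      have := hbal b
      simp [hne] at this
    have hL : lap r s t W 0 0 = 1 := by
      ext i j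
      by_cases hij : i = j
      · subst hij
        simp [lap, lapRow]
      · have : (j : ℤ) ≠ i := fun e => hij (Subtype.ext e.symm)
        simp [lap, lapRow, hij, this]
    simp [tourSum, words, vStarts, hStarts, pairSum, finalFactor, levelFactor, hL]
  | succ n ih =>
    -- The induction hypothesis for the two possible first steps.
    have ihv : a ∈ v → tourSum r s t n (v.erase a) h (a + r)
        = finalFactor t ((v.erase a).count b) (h.count b)
          * (∏ k ∈ W, levelFactor t ((v.erase a).count k) (h.count k))
          * (lap r s t W (v.erase a) h).det := fun ha => by
      refine ih _ _ _ (hbal.erase_v ha) (fun k hk => hW k ?_) ?_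
      · have := Multiset.count_le_of_le k (Multiset.erase_le a v)
        omega
      · have := Multiset.card_erase_add_one ha
        omega
    have ihh : a ∈ h → tourSum r s t n v (h.erase a) (a - s)
        = finalFactor t (v.count b) ((h.erase a).count b)
          * (∏ k ∈ W, levelFactor t (v.count k) ((h.erase a).count k))
          * (lap r s t W v (h.erase a)).det := fun ha => by
      refine ih _ _ _ (hbal.erase_h ha) (fun k hk => hW k ?_) ?_
      · have := Multiset.count_le_of_le k (Multiset.erase_le a h)
        omega
      · have := Multiset.card_erase_add_one ha
        omega
    rw [tourSum_succ]
    have ev : (if a ∈ v then t ^ h.count a * tourSum r s t n (v.erase a) h (a + r) else 0)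
        = if 0 < v.count a then t ^ h.count a * (finalFactor t ((v.erase a).count b) (h.count b)
          * (∏ k ∈ W, levelFactor t ((v.erase a).count k) (h.count k))
          * (lap r s t W (v.erase a) h).det) else 0 := by
      simp only [Multiset.count_pos]
      split_ifs with ha
      · rw [ihv ha]
      · rfl
    have eh : (if a ∈ h then tourSum r s t n v (h.erase a) (a - s) else 0)
        = if 0 < h.count a then (finalFactor t (v.count b) ((h.erase a).count b)
          * (∏ k ∈ W, levelFactor t (v.count k) ((h.erase a).count k))
          * (lap r s t W v (h.erase a)).det) else 0 := by
      simp only [Multiset.count_pos]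
      split_ifs with ha
      · rw [ihh ha]
      · rfl
    rw [ev, eh]
    clear ev eh ihv ihh ih
    by_cases hab : a = b
    · subst hab
      have hk : ∀ k ∈ W, k ≠ a := fun k hk e => hbW (e ▸ hk)
      have hpv : ∏ k ∈ W, levelFactor t ((v.erase a).count k) (h.count k)
          = ∏ k ∈ W, levelFactor t (v.count k) (h.count k) :=
        Finset.prod_congr rfl fun k hk' => by rw [Multiset.count_erase_of_ne (hk k hk') v]
      have hph : ∏ k ∈ W, levelFactor t (v.count k) ((h.erase a).count k)
          = ∏ k ∈ W, levelFactor t (v.count k) (h.count k) :=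
        Finset.prod_congr rfl fun k hk' => by rw [Multiset.count_erase_of_ne (hk k hk') h]
      rw [lap_congr r s t (v := v.erase a) (h := h) (v' := v) (h' := h)
          (fun k hk' => Multiset.count_erase_of_ne (hk k hk') v) (fun _ _ => rfl),
        lap_congr r s t (v := v) (h := h.erase a) (v' := v) (h' := h) (fun _ _ => rfl)
          (fun k hk' => Multiset.count_erase_of_ne (hk k hk') h),
        hpv, hph, Multiset.count_erase_self, Multiset.count_erase_self]
      by_cases h0 : v.count a + h.count a = 0
      · rw [det_lap_eq_zero hbal]
        · simp
        · intro k hk'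
          rcases hW k hk' with h1 | h1
          · exact h1
          · exact absurd (h1 ▸ h0) hk'
        · obtain ⟨k, hk'⟩ : ∃ k, k ∈ v + h := Multiset.card_pos_iff_exists_mem.1 (by simp; omega)
          refine ⟨k, ?_⟩
          rw [← Multiset.count_add]
          exact (Multiset.count_pos.2 hk').ne'
      · rw [finalFactor_recursion ht (x := v.count a) (y := h.count a) (by omega)]
        split_ifs <;> ring
    · have ha0 : v.count a + h.count a ≠ 0 := by
        have := hbal a
        simp only [hab, if_false, if_true] at this
        omega
      have haW : a ∈ W := (hW a ha0).resolve_right hab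
      have hba : b ≠ a := fun e => hab e.symm
      rw [Multiset.count_erase_of_ne hba, Multiset.count_erase_of_ne hba,
        prod_levelFactor_erase haW v h v h (fun _ _ => rfl) (fun _ _ => rfl),
        prod_levelFactor_erase haW v h (v.erase a) h
          (fun k hk => Multiset.count_erase_of_ne hk v) (fun _ _ => rfl),
        prod_levelFactor_erase haW v h v (h.erase a) (fun _ _ => rfl)
          (fun k hk => Multiset.count_erase_of_ne hk h),
        Multiset.count_erase_self, Multiset.count_erase_self,
        lap_erase_v r s t W v h ⟨a, haW⟩, lap_erase_h r s t W v h ⟨a, haW⟩,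
        ← lap_updateRow_self r s t W v h ⟨a, haW⟩]
      simp only [Matrix.updateRow_idem]
      set M := lap r s t W v h with hMdef
      set Q := ∏ k ∈ W.erase a, levelFactor t (v.count k) (h.count k)
      set c := finalFactor t (v.count b) (h.count b)
      by_cases h2 : 2 ≤ v.count a + h.count a
      · have key := levelFactor_recursion ht (M.updateRow ⟨a, haW⟩ fun j : W =>
          (if (j : ℤ) = a then 1 else 0) - (if (j : ℤ) = a + r then 1 else 0)).det
          (M.updateRow ⟨a, haW⟩ fun j : W =>
          (if (j : ℤ) = a then 1 else 0) - (if (j : ℤ) = a - s then 1 else 0)).det h2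
        rw [← det_updateRow_lapRow r s t W M ⟨a, haW⟩ (by omega),
          ← det_updateRow_lapRow r s t W M ⟨a, haW⟩ (by omega),
          ← det_updateRow_lapRow r s t W M ⟨a, haW⟩ (by omega)] at key
        simp only at key
        refine Eq.trans ?_ (Eq.trans (congrArg (fun z => c * Q * z) key.symm) (by ring))
        split_ifs <;> ring
      · -- The last departure from `a`: nothing arrives there any more.
        have hcol : ∀ i, i ≠ (⟨a, haW⟩ : W) → M i ⟨a, haW⟩ = 0 := by
          intro i hi
          have hia : a ≠ i := fun e => hi (Subtype.ext e.symm)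
          have hin := hbal a
          simp only [hab, if_false, if_true] at hin
          have e1 : a = i + r → v.count (i : ℤ) = 0 := fun e => by
            rw [show (i : ℤ) = a - r by omega]; omega
          have e2 : a = i - s → h.count (i : ℤ) = 0 := fun e => by
            rw [show (i : ℤ) = a + s by omega]; omega
          simp only [hMdef, lap, Matrix.of_apply, lapRow, hia, if_false]
          split_ifs with h3 h4 h4
          · simp [e1 h3, e2 h4]
          · simp [e1 h3]
          · simp [e2 h4]
          · simp
        have hrow0 : lapRow r s t W a 0 0 = fun j : W => if (j : ℤ) = a then 1 else 0 := by
          funext j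
          simp [lapRow]
        rcases Nat.eq_zero_or_pos (v.count a) with h3 | h3
        · have h4 : h.count a = 1 := by omega
          simp only [h3, h4, det_updateRow_lapRow r s t W M ⟨a, haW⟩ (x := 0) (y := 1) (by omega)]
          have := det_updateRow_of_column_eq_zero M ⟨a, haW⟩ hcol (c := a - s) (by simpa using hs)
          simp only at this
          simp [this, hrow0, levelFactor, qFact]
        · have h3 : v.count a = 1 := by omega
          have h4 : h.count a = 0 := by omega
          simp only [h3, h4, det_updateRow_lapRow r s t W M ⟨a, haW⟩ (x := 1) (y := 0) (by omega)]
          have := det_updateRow_of_column_eq_zero M ⟨a, haW⟩ hcol (c := a + r) (by simpa using hr)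
          simp only at this
          simp [this, hrow0, levelFactor, qFact]

/-! ### Reversal of words, and the symmetry between departures and arrivals -/

/-- The word of the reversed walk, which reads the word backwards and exchanges upward and downward
steps, along with the step sizes `r` and `s`. -/
def rev (w : List Bool) : List Bool := (w.map not).reverse

theorem rev_cons (x : Bool) (w : List Bool) : rev (x :: w) = rev w ++ [!x] := by simp [rev]

theorem rev_rev (w : List Bool) : rev (rev w) = w := by
  simp [rev, List.map_reverse, Function.comp_def]

theorem length_rev (w : List Bool) : (rev w).length = w.length := by simp [rev]

theorem count_true_rev (w : List Bool) : (rev w).count true = w.count false := by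
  induction w with
  | nil => rfl
  | cons x w ih => cases x <;> simp [rev_cons, ih]

theorem count_false_rev (w : List Bool) : (rev w).count false = w.count true := by
  induction w with
  | nil => rfl
  | cons x w ih => cases x <;> simp [rev_cons, ih]

theorem vStarts_append (r s : ℤ) (w w' : List Bool) (a : ℤ) :
    vStarts r s (w ++ w') a = vStarts r s w a + vStarts r s w' (endLevel r s w a) := by
  induction w generalizing a with
  | nil => simp [vStarts, endLevel]
  | cons x w ih => cases x <;> simp [vStarts, endLevel, ih]

theorem hStarts_append (r s : ℤ) (w w' : List Bool) (a : ℤ) :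
    hStarts r s (w ++ w') a = hStarts r s w a + hStarts r s w' (endLevel r s w a) := by
  induction w generalizing a with
  | nil => simp [hStarts, endLevel]
  | cons x w ih => cases x <;> simp [hStarts, endLevel, ih]

theorem pairSum_append_true (r s : ℤ) (φ : ℤ → ℕ) (w : List Bool) (a : ℤ) :
    pairSum r s φ (w ++ [true]) a = pairSum r s φ w a := by
  induction w generalizing a with
  | nil => simp [pairSum, hStarts]
  | cons x w ih => cases x <;> simp [pairSum, ih, hStarts_append, hStarts]

theorem pairSum_append_false (r s : ℤ) (φ : ℤ → ℕ) (w : List Bool) (a : ℤ) :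
    pairSum r s φ (w ++ [false]) a
      = pairSum r s φ w a + ((vStarts r s w a).map fun e => φ (endLevel r s w a - e)).sum := by
  induction w generalizing a with
  | nil => simp [pairSum, vStarts]
  | cons x w ih =>
    cases x
    · simp [pairSum, ih, vStarts, endLevel]
    · simp [pairSum, ih, vStarts, endLevel, hStarts_append, hStarts]
      ring

theorem endLevel_rev (r s : ℤ) (w : List Bool) (a : ℤ) :
    endLevel s r (rev w) (endLevel r s w a) = a := by
  rw [endLevel_eq, endLevel_eq, count_true_rev, count_false_rev]
  ring

theorem vStarts_rev (r s : ℤ) (w : List Bool) (a : ℤ) :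
    vStarts s r (rev w) (endLevel r s w a) = (hStarts r s w a).map (· - s) := by
  induction w generalizing a with
  | nil => rfl
  | cons x w ih =>
    cases x
    · simp only [rev_cons, vStarts_append, endLevel, ih, hStarts, Multiset.map_cons, endLevel_rev,
        Bool.not_false, vStarts]
      simp [add_comm]
    · simp only [rev_cons, vStarts_append, endLevel, ih, hStarts, Bool.not_true, vStarts]
      simp

theorem hStarts_rev (r s : ℤ) (w : List Bool) (a : ℤ) :
    hStarts s r (rev w) (endLevel r s w a) = (vStarts r s w a).map (· + r) := by
  induction w generalizing a with
  | nil => rfl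
  | cons x w ih =>
    cases x
    · simp only [rev_cons, hStarts_append, endLevel, ih, vStarts, Bool.not_false, hStarts]
      simp
    · simp only [rev_cons, hStarts_append, endLevel, ih, vStarts, Multiset.map_cons, endLevel_rev,
        Bool.not_true, hStarts]
      simp [add_comm, ← Multiset.singleton_add]

theorem pairSum_rev (r s : ℤ) (φ : ℤ → ℕ) (w : List Bool) (a : ℤ) :
    pairSum s r φ (rev w) (endLevel r s w a) = pairSum r s (fun d => φ (r + s - d)) w a := by
  induction w generalizing a with
  | nil => rfl
  | cons x w ih =>
    cases x
    · simp only [rev_cons, Bool.not_false, pairSum_append_true, endLevel, pairSum, ih]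
    · simp only [rev_cons, Bool.not_true, pairSum_append_false, endLevel, pairSum, ih,
        endLevel_rev, vStarts_rev, Multiset.map_map, Function.comp_apply]
      rw [add_comm]
      congr 3
      funext f
      congr 1
      ring

/-- The generating function of closed walks by the number of pairs with `d = r + s` (that is, of
inversions in the sequences of arrivals at each level) is the one by inversions of departures of
the reversed walks. -/
theorem sum_arrivals_eq_tourSum (r s : ℤ) (t : ℝ) (n : ℕ) (v h : Multiset ℤ) (a : ℤ)
    (hc : r * Multiset.card v = s * Multiset.card h) :
    (∑ w ∈ words n, if vStarts r s w a = v ∧ hStarts r s w a = h then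
      t ^ pairSum r s (fun d => if d = r + s then 1 else 0) w a else 0)
      = tourSum s r t n (h.map (· - s)) (v.map (· + r)) a := by
  rw [tourSum]
  refine Finset.sum_nbij' rev rev ?_ ?_ (fun w _ => rev_rev w) (fun w _ => rev_rev w) ?_
  · intro w hw
    rw [mem_words] at hw ⊢
    rw [length_rev, hw]
  · intro w hw
    rw [mem_words] at hw ⊢
    rw [length_rev, hw]
  · intro w _
    by_cases hw : endLevel r s w a = a
    · have h1 := vStarts_rev r s w a
      have h2 := hStarts_rev r s w a
      have h3 := pairSum_rev r s (fun d => if d = 0 then 1 else 0) w a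
      rw [hw] at h1 h2 h3
      rw [h3]
      refine if_congr ?_ (by simp only [sub_eq_zero, @eq_comm _ (r + s)]) rfl
      rw [h1, h2, (Multiset.map_injective sub_left_injective).eq_iff,
        (Multiset.map_injective (add_left_injective r)).eq_iff, and_comm]
    · rw [if_neg, if_neg]
      · rintro ⟨h1, h2⟩
        apply hw
        have h3 := congrArg Multiset.card h1
        have h4 := congrArg Multiset.card h2
        rw [card_vStarts, Multiset.card_map, count_true_rev] at h3
        rw [card_hStarts, Multiset.card_map, count_false_rev] at h4
        rw [endLevel_eq, h3, h4, hc]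
        ring
      · rintro ⟨h1, h2⟩
        apply hw
        rw [endLevel_eq, ← card_vStarts r s w a, ← card_hStarts r s w a, h1, h2, hc]
        ring

/-- The exponent of `t` in the diagonal matrix that conjugates the Laplacian matrix for departures
to the transposed one for arrivals: the number of upward departures from the levels `k + s`,
`k + 2 s`, …. -/
def conjExponent (s : ℤ) (v : Multiset ℤ) (k : ℤ) : ℕ := v.countP fun e => k < e ∧ s ∣ e - k

theorem conjExponent_sub {s : ℤ} (hs : 0 < s) (v : Multiset ℤ) (k : ℤ) :
    conjExponent s v (k - s) = conjExponent s v k + v.count k := by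
  induction v using Multiset.induction_on with
  | empty => simp [conjExponent]
  | cons e v ih =>
    simp only [conjExponent, Multiset.countP_cons, Multiset.count_cons] at ih ⊢
    have h1 : s ∣ e - (k - s) ↔ s ∣ e - k := by
      rw [show e - (k - s) = e - k + s by ring, dvd_add_self_right]
    rw [ih]
    by_cases h2 : k = e
    · subst h2
      simp [hs]
      omega
    · by_cases h3 : s ∣ e - k
      · have h4 : k - s < e ↔ k < e := by
          constructor
          · intro h5
            obtain ⟨c, hc⟩ := h3
            have : 0 < s * (c + 1) := by rw [mul_add]; omega
            have h6 : 0 < c + 1 := (pos_iff_pos_of_mul_pos this).1 hs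
            have h7 : c ≠ 0 := by
              rintro rfl
              omega
            have : 0 < s * c := mul_pos hs (by omega)
            omega
          · intro h5
            omega
        simp [h1, h2, h4]
        omega
      · simp [h1, h2, h3]

theorem exists_bound (m : Multiset ℤ) : ∃ N : ℤ, ∀ e ∈ m, e ≤ N := by
  induction m using Multiset.induction_on with
  | empty => exact ⟨0, by simp⟩
  | cons x m ih =>
    obtain ⟨N, hN⟩ := ih
    refine ⟨max x N, fun e he => ?_⟩
    rcases Multiset.mem_cons.1 he with rfl | he
    · exact le_max_left _ _
    · exact (hN e he).trans (le_max_right _ _)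

theorem conjExponent_add {r s : ℤ} (hr : 0 < r) (hs : 0 < s) {v h : Multiset ℤ} {b : ℤ}
    (hbal : Balanced r s b b v h) (k : ℤ) :
    conjExponent s v k = conjExponent s v (k + r) + h.count (k + r + s) := by
  obtain ⟨N, hN⟩ := exists_bound (v + h)
  induction hm : (N - k).toNat using Nat.strong_induction_on generalizing k with
  | _ m ih =>
    by_cases hk : N ≤ k
    · have h0 : ∀ k', N ≤ k' → conjExponent s v k' = 0 := fun k' hk' => by
        rw [conjExponent, Multiset.countP_eq_zero]
        intro e he
        have := hN e (Multiset.mem_add.2 (Or.inl he))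
        omega
      rw [h0 k hk, h0 (k + r) (by omega), Multiset.count_eq_zero_of_notMem]
      intro he
      have := hN _ (Multiset.mem_add.2 (Or.inr he))
      omega
    · have h1 := ih _ (by omega) (k + s) rfl
      have h2 := conjExponent_sub hs v (k + s)
      have h3 := conjExponent_sub hs v (k + r + s)
      have h4 := hbal (k + r + s)
      rw [add_sub_cancel_right] at h2 h3
      rw [show k + r + s - r = k + s by ring] at h4
      rw [show k + s + r = k + r + s by ring] at h1
      omega

theorem count_map_sub (m : Multiset ℤ) (s k : ℤ) : (m.map (· - s)).count k = m.count (k + s) := by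
  rw [← Multiset.count_map_eq_count' (· - s) m sub_left_injective, add_sub_cancel_right]

theorem count_map_add (m : Multiset ℤ) (r k : ℤ) : (m.map (· + r)).count k = m.count (k - r) := by
  rw [← Multiset.count_map_eq_count' (· + r) m (add_left_injective r), sub_add_cancel]

theorem Balanced.rev {r s b : ℤ} {v h : Multiset ℤ} (hbal : Balanced r s b b v h) :
    Balanced s r b b (h.map (· - s)) (v.map (· + r)) := by
  intro k
  have := hbal k
  simp only [count_map_sub, count_map_add, sub_add_cancel, add_sub_cancel_right]
  omega

/-- The Laplacian matrices for the departures of a closed walk and of its reversal are conjugate,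
up to transposition. -/
theorem det_lap_rev {r s : ℤ} (hr : 0 < r) (hs : 0 < s) {t : ℝ} (ht : 0 < t) {W : Finset ℤ}
    {v h : Multiset ℤ} {b : ℤ} (hbal : Balanced r s b b v h) :
    (lap s r t W (h.map (· - s)) (v.map (· + r))).det = (lap r s t W v h).det := by
  set D : Matrix W W ℝ := Matrix.diagonal fun i => t ^ conjExponent s v i with hD
  have hdet : D.det ≠ 0 := by
    rw [hD, Matrix.det_diagonal]
    exact Finset.prod_ne_zero_iff.2 fun i _ => by positivity
  have key : (lap s r t W (h.map (· - s)) (v.map (· + r))).transpose * D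
      = D * lap r s t W v h := by
    ext i j
    rw [hD, Matrix.mul_diagonal, Matrix.diagonal_mul, Matrix.transpose_apply]
    simp only [lap, Matrix.of_apply, lapRow, count_map_sub, count_map_add]
    have hn : h.count ((j : ℤ) + s) + v.count ((j : ℤ) - r)
        = v.count (j : ℤ) + h.count (j : ℤ) := by
      have := hbal j
      omega
    rw [hn]
    by_cases h1 : (j : ℤ) = i
    · have h2 : (i : ℤ) ≠ j + s := by omega
      have h3 : (i : ℤ) ≠ j - r := by omega
      have h4 : (j : ℤ) ≠ i + r := by omega
      have h5 : (j : ℤ) ≠ i - s := by omega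
      rw [if_pos h1.symm, if_neg h2, if_neg h3, if_pos h1, if_neg h4, if_neg h5, h1]
      ring
    · have h1' : ¬ (i : ℤ) = j := fun e => h1 e.symm
      by_cases h2 : (j : ℤ) = i + r
      · have h3 : (i : ℤ) = j - r := by omega
        have h4 : (i : ℤ) ≠ j + s := by omega
        have h5 : (j : ℤ) ≠ i - s := by omega
        rw [if_neg h1', if_neg h4, if_pos h3, if_neg h1, if_pos h2, if_neg h5,
          conjExponent_add hr hs hbal i, ← h2, ← h3]
        ring
      · by_cases h5 : (j : ℤ) = i - s
        · have h4 : (i : ℤ) = j + s := by omega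
          have h3 : (i : ℤ) ≠ j - r := by omega
          have h6 := conjExponent_sub hs v i
          rw [← h5] at h6
          rw [if_neg h1', if_pos h4, if_neg h3, if_neg h1, if_neg h2, if_pos h5, ← h4, h6]
          ring
        · have h4 : (i : ℤ) ≠ j + s := by omega
          have h3 : (i : ℤ) ≠ j - r := by omega
          rw [if_neg h1', if_neg h4, if_neg h3, if_neg h1, if_neg h2, if_neg h5]
          ring
  have := congrArg Matrix.det key
  rw [Matrix.det_mul, Matrix.det_mul, Matrix.det_transpose, mul_comm] at this
  exact mul_left_cancel₀ hdet this

/-- A product over all visited levels does not change if the levels are shifted. -/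
theorem prod_qFact_shift (t : ℝ) (m : Multiset ℤ) (S : Finset ℤ) (c : ℤ)
    (h1 : ∀ k, m.count k ≠ 0 → k ∈ S) (h2 : ∀ k, m.count (k + c) ≠ 0 → k ∈ S) :
    ∏ k ∈ S, qFact t (m.count (k + c)) = ∏ k ∈ S, qFact t (m.count k) := by
  rw [← finprod_eq_prod_of_mulSupport_subset (fun k => qFact t (m.count (k + c))),
    ← finprod_eq_prod_of_mulSupport_subset (fun k => qFact t (m.count k))]
  · exact finprod_comp_equiv (Equiv.addRight c) (f := fun k => qFact t (m.count k))
  · intro k hk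
    refine h1 k fun h0 => hk ?_
    simp [h0]
  · intro k hk
    refine h2 k fun h0 => hk ?_
    simp [h0]

theorem finalFactor_mul_prod (t : ℝ) {W : Finset ℤ} {b : ℤ} (hb : b ∉ W) (x y : ℤ → ℕ) :
    finalFactor t (x b) (y b) * ∏ k ∈ W, levelFactor t (x k) (y k)
      = (qFact t (x b + y b) * ∏ k ∈ W, qFact t (x k + y k - 1))
        / ((∏ k ∈ insert b W, qFact t (x k)) * ∏ k ∈ insert b W, qFact t (y k)) := by
  simp only [finalFactor, levelFactor, Finset.prod_div_distrib, Finset.prod_mul_distrib,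
    Finset.prod_insert hb]
  rw [div_mul_div_comm]
  congr 1
  ring

theorem tourSum_rev {r s : ℤ} (hr : 0 < r) (hs : 0 < s) {t : ℝ} (ht : 0 < t)
    {v h : Multiset ℤ} {b : ℤ} (hbal : Balanced r s b b v h) (n : ℕ)
    (hn : Multiset.card v + Multiset.card h = n) :
    tourSum s r t n (h.map (· - s)) (v.map (· + r)) b = tourSum r s t n v h b := by
  set W := (v.toFinset ∪ h.toFinset).erase b with hW
  have hbW : b ∉ W := by simp [hW]
  have hsupp : ∀ k, v.count k + h.count k ≠ 0 → k ∈ insert b W := by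
    intro k hk
    have : k ∈ v ∨ k ∈ h := by
      by_contra hc
      push Not at hc
      simp [Multiset.count_eq_zero_of_notMem hc.1, Multiset.count_eq_zero_of_notMem hc.2] at hk
    simp only [hW, Finset.mem_insert, Finset.mem_erase, Finset.mem_union, Multiset.mem_toFinset]
    tauto
  have hn' : ∀ k, h.count (k + s) + v.count (k - r) = v.count k + h.count k := fun k => by
    have := hbal k
    omega
  rw [tourSum_eq hr.ne' hs.ne' ht hbW n v h b hbal
      (fun k hk => (Finset.mem_insert.1 (hsupp k hk)).symm) hn,
    tourSum_eq hs.ne' hr.ne' ht hbW n _ _ b hbal.rev (fun k hk => ?_) (by simp; omega),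
    det_lap_rev hr hs ht hbal, finalFactor_mul_prod t hbW (fun k => v.count k) (fun k => h.count k),
    finalFactor_mul_prod t hbW (fun k => (h.map (· - s)).count k)
      (fun k => (v.map (· + r)).count k)]
  · simp only [count_map_sub, count_map_add, hn']
    rw [prod_qFact_shift t h _ s (fun k hk => hsupp k (by omega))
      (fun k hk => hsupp k (by rw [← hn']; omega))]
    have := prod_qFact_shift t v (insert b W) (-r) (fun k hk => hsupp k (by omega))
      (fun k hk => hsupp k (by rw [← sub_eq_add_neg] at hk; rw [← hn']; omega))
    simp only [← sub_eq_add_neg] at this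
    rw [this, mul_comm (∏ k ∈ insert b W, qFact t (h.count k))]
  · rw [count_map_sub, count_map_add, hn'] at hk
    exact (Finset.mem_insert.1 (hsupp k hk)).symm

/-- In each class of closed walks with the same start levels, the numbers of inversions of
departures and of arrivals have the same distribution. -/
theorem sum_departures_eq_sum_arrivals {r s : ℤ} (hr : 0 < r) (hs : 0 < s) {t : ℝ} (ht : 0 < t)
    {n : ℕ} {w₀ : List Bool} (hw₀ : w₀ ∈ words n)
    (hc : r * w₀.count true = s * w₀.count false) :
    (∑ w ∈ words n with vStarts r s w 0 = vStarts r s w₀ 0 ∧ hStarts r s w 0 = hStarts r s w₀ 0,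
      t ^ pairSum r s (fun d => if d = 0 then 1 else 0) w 0)
    = ∑ w ∈ words n with vStarts r s w 0 = vStarts r s w₀ 0 ∧ hStarts r s w 0 = hStarts r s w₀ 0,
      t ^ pairSum r s (fun d => if d = r + s then 1 else 0) w 0 := by
  have hbal : Balanced r s 0 0 (vStarts r s w₀ 0) (hStarts r s w₀ 0) := by
    intro k
    have := count_starts_balance r s w₀ 0 k
    rwa [endLevel_eq, hc, zero_add, sub_self] at this
  rw [Finset.sum_filter, Finset.sum_filter,
    sum_arrivals_eq_tourSum r s t n _ _ 0 (by rw [card_vStarts, card_hStarts, hc]),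
    tourSum_rev hr hs ht hbal n, tourSum]
  rw [card_vStarts, card_hStarts, ← mem_words.1 hw₀, List.count_true_add_count_false]

/-- Wall-crossing at the slope `r / s`: among the closed walks with a given number `N` of pairs,
the numbers of pairs with `0 ≤ d < r + s` and with `0 < d ≤ r + s` have the same distribution. -/
theorem sum_closed_words {r s : ℤ} (hr : 0 < r) (hs : 0 < s) {t : ℝ} (ht : 0 < t) (A B N : ℕ)
    (hAB : r * B = s * A) :
    (∑ w ∈ words (A + B) with (w.count true = B ∧ w.count false = A) ∧
        pairSum r s (fun _ => 1) w 0 = N,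
      t ^ pairSum r s (fun d => if 0 ≤ d ∧ d < r + s then 1 else 0) w 0)
    = ∑ w ∈ words (A + B) with (w.count true = B ∧ w.count false = A) ∧
        pairSum r s (fun _ => 1) w 0 = N,
      t ^ pairSum r s (fun d => if 0 < d ∧ d ≤ r + s then 1 else 0) w 0 := by
  set T := {w ∈ words (A + B) | (w.count true = B ∧ w.count false = A) ∧
        pairSum r s (fun _ => 1) w 0 = N} with hT
  set g : List Bool → Multiset ℤ × Multiset ℤ := fun w => (vStarts r s w 0, hStarts r s w 0)
  have hg : ∀ w ∈ T, g w ∈ T.image g := fun w hw => Finset.mem_image_of_mem g hw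
  rw [← Finset.sum_fiberwise_of_maps_to hg, ← Finset.sum_fiberwise_of_maps_to hg]
  refine Finset.sum_congr rfl fun c hcT => ?_
  obtain ⟨w₀, hw₀, rfl⟩ := Finset.mem_image.1 hcT
  rw [hT, Finset.mem_filter] at hw₀
  have hfib : {w ∈ T | g w = g w₀} = {w ∈ words (A + B) |
      vStarts r s w 0 = vStarts r s w₀ 0 ∧ hStarts r s w 0 = hStarts r s w₀ 0} := by
    ext w
    simp only [hT, Finset.mem_filter, g, Prod.mk.injEq]
    constructor
    · rintro ⟨⟨h1, -⟩, h2⟩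
      exact ⟨h1, h2⟩
    · rintro ⟨h1, h2⟩
      refine ⟨⟨h1, ⟨?_, ?_⟩, ?_⟩, h2⟩
      · rw [← card_vStarts r s w 0, h2.1, card_vStarts, hw₀.2.1.1]
      · rw [← card_hStarts r s w 0, h2.2, card_hStarts, hw₀.2.1.2]
      · rw [pairSum_one_congr hr hs h2.1 h2.2, hw₀.2.2]
  have h1 : ∀ w, pairSum r s (fun d => if 0 ≤ d ∧ d < r + s then 1 else 0) w 0
      = pairSum r s (fun d => if 0 < d ∧ d < r + s then 1 else 0) w 0
        + pairSum r s (fun d => if d = 0 then 1 else 0) w 0 := fun w => by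
    rw [← pairSum_add]
    congr 1
    funext d
    split_ifs <;> omega
  have h2 : ∀ w, pairSum r s (fun d => if 0 < d ∧ d ≤ r + s then 1 else 0) w 0
      = pairSum r s (fun d => if 0 < d ∧ d < r + s then 1 else 0) w 0
        + pairSum r s (fun d => if d = r + s then 1 else 0) w 0 := fun w => by
    rw [← pairSum_add]
    congr 1
    funext d
    split_ifs <;> omega
  set M := pairSum r s (fun d => if 0 < d ∧ d < r + s then 1 else 0) w₀ 0 with hM
  have h3 : ∀ w ∈ {w ∈ T | g w = g w₀},
      pairSum r s (fun d => if 0 < d ∧ d < r + s then 1 else 0) w 0 = M := fun w hw => by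
    rw [hfib, Finset.mem_filter] at hw
    exact pairSum_mid_congr hr hs hw.2.1 hw.2.2
  have h4 : ∀ w ∈ {w ∈ T | g w = g w₀},
      t ^ pairSum r s (fun d => if 0 ≤ d ∧ d < r + s then 1 else 0) w 0
        = t ^ M * t ^ pairSum r s (fun d => if d = 0 then 1 else 0) w 0 := fun w hw => by
    rw [h1, h3 w hw, pow_add]
  have h5 : ∀ w ∈ {w ∈ T | g w = g w₀},
      t ^ pairSum r s (fun d => if 0 < d ∧ d ≤ r + s then 1 else 0) w 0
        = t ^ M * t ^ pairSum r s (fun d => if d = r + s then 1 else 0) w 0 := fun w hw => by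
    rw [h2, h3 w hw, pow_add]
  rw [Finset.sum_congr rfl h4, Finset.sum_congr rfl h5, ← Finset.mul_sum, ← Finset.mul_sum, hfib,
    sum_departures_eq_sum_arrivals hr hs ht hw₀.1 (by rw [hw₀.2.1.1, hw₀.2.1.2, hAB])]

/-! ### Words and Young diagrams -/

/-- The row lengths of the partition with boundary word `w`: the row of a step `true` has as many
cells as there are steps `false` after it. -/
def rowFun : List Bool → ℕ → ℕ
  | [], _ => 0
  | true :: w, 0 => w.count false
  | true :: w, i + 1 => rowFun w i
  | false :: w, i => rowFun w i

theorem rowFun_le (w : List Bool) (i : ℕ) : rowFun w i ≤ w.count false := by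
  induction w generalizing i with
  | nil => simp [rowFun]
  | cons x w ih =>
    cases x
    · have := ih i
      simp [rowFun]
      omega
    · cases i with
      | zero => simp [rowFun]
      | succ i => simpa [rowFun] using ih i

theorem rowFun_antitone (w : List Bool) : Antitone (rowFun w) := by
  refine antitone_nat_of_succ_le fun i => ?_
  induction w generalizing i with
  | nil => simp [rowFun]
  | cons x w ih =>
    cases x
    · simpa [rowFun] using ih i
    · cases i with
      | zero => simpa [rowFun] using rowFun_le w 0
      | succ i => simpa [rowFun] using ih i

theorem rowFun_eq_zero (w : List Bool) {i : ℕ} (hi : w.count true ≤ i) : rowFun w i = 0 := by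
  induction w generalizing i with
  | nil => simp [rowFun]
  | cons x w ih =>
    cases x
    · simpa [rowFun] using ih (by simpa using hi)
    · cases i with
      | zero => simp at hi
      | succ i => simpa [rowFun] using ih (by simpa using hi)

/-- The Young diagram with boundary word `w`. -/
def diag (w : List Bool) : YoungDiagram where
  cells := {x ∈ Finset.range (w.count true) ×ˢ Finset.range (w.count false) | x.2 < rowFun w x.1}
  isLowerSet := by
    rintro ⟨i, j⟩ ⟨i', j'⟩ hle hx
    obtain ⟨hi, hj⟩ := Prod.mk_le_mk.1 hle
    simp only [Finset.coe_filter, Finset.mem_product, Finset.mem_range, Set.mem_ofPred_eq] at hx ⊢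
    have := rowFun_antitone w hi
    omega

theorem mem_diag {w : List Bool} {i j : ℕ} : (i, j) ∈ diag w ↔ j < rowFun w i := by
  rw [← YoungDiagram.mem_cells]
  simp only [diag, Finset.mem_filter, Finset.mem_product, Finset.mem_range, and_iff_right_iff_imp]
  intro h
  refine ⟨?_, h.trans_le (rowFun_le w i)⟩
  by_contra hc
  rw [rowFun_eq_zero w (not_lt.1 hc)] at h
  exact absurd h (Nat.not_lt_zero _)

theorem rowLen_diag (w : List Bool) (i : ℕ) : (diag w).rowLen i = rowFun w i :=
  eq_of_forall_lt_iff fun j => by rw [← YoungDiagram.mem_iff_lt_rowLen, mem_diag]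

theorem diag_false (w : List Bool) : diag (false :: w) = diag w := by
  ext ⟨i, j⟩
  rw [YoungDiagram.mem_cells, YoungDiagram.mem_cells, mem_diag, mem_diag, rowFun]

theorem colLen_diag_true (w : List Bool) {j : ℕ} (hj : j < w.count false) :
    (diag (true :: w)).colLen j = (diag w).colLen j + 1 :=
  eq_of_forall_lt_iff fun i => by
    rw [← YoungDiagram.mem_iff_lt_colLen, mem_diag]
    cases i with
    | zero => simpa [rowFun] using hj
    | succ i =>
      rw [rowFun, ← mem_diag, YoungDiagram.mem_iff_lt_colLen, Nat.add_lt_add_iff_right]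

theorem colLen_diag_eq_zero (w : List Bool) {j : ℕ} (hj : w.count false ≤ j) :
    (diag w).colLen j = 0 := by
  by_contra hc
  have h1 : (0, j) ∈ diag w := YoungDiagram.mem_iff_lt_colLen.2 (Nat.pos_of_ne_zero hc)
  rw [mem_diag] at h1
  have := rowFun_le w 0
  omega

theorem cells_diag_true (w : List Bool) : (diag (true :: w)).cells =
    (Finset.range (w.count false)).image (fun j => (0, j))
      ∪ (diag w).cells.image (fun x => (x.1 + 1, x.2)) := by
  ext ⟨i, j⟩
  rw [YoungDiagram.mem_cells, mem_diag]
  cases i with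
  | zero => simp [rowFun]
  | succ i => simp [rowFun, mem_diag]

theorem sum_cells_diag_true {M : Type*} [AddCommMonoid M] (w : List Bool) (G : ℕ × ℕ → M) :
    ∑ x ∈ (diag (true :: w)).cells, G x =
      ∑ j ∈ Finset.range (w.count false), G (0, j)
        + ∑ x ∈ (diag w).cells, G (x.1 + 1, x.2) := by
  rw [cells_diag_true, Finset.sum_union, Finset.sum_image, Finset.sum_image]
  · rintro ⟨i, j⟩ - ⟨i', j'⟩ - h
    simpa using h
  · intro i _ j _ h
    simpa using h
  · rw [Finset.disjoint_left]
    rintro x h1 h2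
    obtain ⟨j, -, rfl⟩ := Finset.mem_image.1 h1
    obtain ⟨y, -, h⟩ := Finset.mem_image.1 h2
    simp at h

/-- The step `false` with `j` further ones after it is the bottom of column `j`. -/
theorem sum_hStarts (r s : ℤ) (ψ : ℤ → ℕ) (w : List Bool) (a : ℤ) :
    ((hStarts r s w a).map ψ).sum = ∑ j ∈ Finset.range (w.count false),
      ψ (a + r * (diag w).colLen j - s * ((w.count false : ℤ) - 1 - j)) := by
  induction w generalizing a with
  | nil => simp [hStarts]
  | cons x w ih =>
    cases x
    · rw [hStarts, Multiset.map_cons, Multiset.sum_cons, ih, List.count_cons_self,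
        Finset.sum_range_succ, add_comm, diag_false, colLen_diag_eq_zero w le_rfl]
      congr 1
      · refine Finset.sum_congr rfl fun j _ => ?_
        congr 1
        push_cast
        ring
      · congr 1
        push_cast
        ring
    · rw [hStarts, ih, List.count_cons_of_ne (by decide)]
      refine Finset.sum_congr rfl fun j hj => ?_
      rw [colLen_diag_true w (Finset.mem_range.1 hj)]
      congr 1
      push_cast
      ring

theorem pairSum_eq_sum_cells (r s : ℤ) (φ : ℤ → ℕ) (w : List Bool) (a : ℤ) :
    pairSum r s φ w a = ∑ x ∈ (diag w).cells,
      φ (r * ((leg (diag w) x : ℤ) + 1) - s * (arm (diag w) x : ℤ)) := by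
  induction w generalizing a with
  | nil =>
    rw [Finset.sum_eq_zero]
    · rfl
    · rintro ⟨i, j⟩ hx
      rw [YoungDiagram.mem_cells, mem_diag] at hx
      simp [rowFun] at hx
  | cons x w ih =>
    cases x
    · rw [pairSum, ih, diag_false]
    · rw [pairSum, ih, sum_cells_diag_true, sum_hStarts]
      congr 1
      · refine Finset.sum_congr rfl fun j hj => ?_
        have hj' := Finset.mem_range.1 hj
        have h1 : leg (diag (true :: w)) (0, j) = (diag w).colLen j := by
          simp only [leg, colLen_diag_true w hj']
          omega
        have h2 : (arm (diag (true :: w)) (0, j) : ℤ) = w.count false - 1 - j := by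
          simp only [arm, rowLen_diag, rowFun]
          omega
        rw [h1, h2]
        congr 1
        ring
      · refine Finset.sum_congr rfl fun x hx => ?_
        have hj : x.2 < w.count false := by
          rw [YoungDiagram.mem_cells, mem_diag] at hx
          exact hx.trans_le (rowFun_le w _)
        have h1 : leg (diag (true :: w)) (x.1 + 1, x.2) = leg (diag w) x := by
          simp only [leg, colLen_diag_true w hj]
          omega
        have h2 : arm (diag (true :: w)) (x.1 + 1, x.2) = arm (diag w) x := by
          simp only [arm, rowLen_diag, rowFun]
        rw [h1, h2]

theorem diag_injective {w w' : List Bool} (ht : w.count true = w'.count true)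
    (hf : w.count false = w'.count false) (h : diag w = diag w') : w = w' := by
  have hrow : ∀ i, rowFun w i = rowFun w' i := fun i => by rw [← rowLen_diag, h, rowLen_diag]
  clear h
  induction w generalizing w' with
  | nil =>
    cases w' with
    | nil => rfl
    | cons x w' => cases x <;> simp at ht hf
  | cons x w ih =>
    cases w' with
    | nil => cases x <;> simp at ht hf
    | cons y w' =>
      cases x <;> cases y
      · exact congrArg (List.cons false) (ih (by simpa using ht) (by simpa using hf) hrow)
      · have h1 := hrow 0
        have h2 := rowFun_le w 0
        simp only [rowFun, List.count_cons_self] at h1 hf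
        rw [List.count_cons_of_ne (by decide)] at hf
        omega
      · have h1 := hrow 0
        have h2 := rowFun_le w' 0
        simp only [rowFun, List.count_cons_self] at h1 hf
        rw [List.count_cons_of_ne (by decide)] at hf
        omega
      · exact congrArg (List.cons true)
          (ih (by simpa using ht) (by simpa using hf) fun i => hrow (i + 1))

theorem exists_word (A B : ℕ) (ρ : ℕ → ℕ) (hρ : Antitone ρ) (hA : ρ 0 ≤ A)
    (hB : ∀ i, B ≤ i → ρ i = 0) :
    ∃ w : List Bool, w.count true = B ∧ w.count false = A ∧ rowFun w = ρ := by
  induction hn : A + B generalizing A B ρ with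
  | zero =>
    refine ⟨[], by simp; omega, by simp; omega, ?_⟩
    funext i
    rw [hB i (by omega), rowFun]
  | succ n ih =>
    by_cases h : 0 < B ∧ ρ 0 = A
    · obtain ⟨w, h1, h2, h3⟩ := ih A (B - 1) (fun i => ρ (i + 1))
        (fun i j hij => hρ (by omega)) ((hρ (by omega)).trans hA)
        (fun i hi => hB _ (by omega)) (by omega)
      refine ⟨true :: w, by simp [h1]; omega, by simp [h2], ?_⟩
      funext i
      cases i with
      | zero => rw [rowFun, h2, h.2]
      | succ i => rw [rowFun, h3]
    · have hA' : ρ 0 < A := by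
        rcases Nat.eq_zero_or_pos B with h0 | h0
        · rw [hB 0 (by omega)]
          omega
        · exact lt_of_le_of_ne hA fun e => h ⟨h0, e⟩
      obtain ⟨w, h1, h2, h3⟩ := ih (A - 1) B ρ hρ (by omega) hB (by omega)
      refine ⟨false :: w, by simp [h1], by simp [h2]; omega, ?_⟩
      funext i
      rw [rowFun, h3]

/-! ### Partitions of a given size and the crossing of all slopes -/

/-- The hook from the corner to a cell lies in the diagram. -/
theorem add_lt_area {μ : YoungDiagram} {i j : ℕ} (h : (i, j) ∈ μ) : i + j < area μ := by
  have : (Finset.range (i + j + 1)).card ≤ μ.cells.card := by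
    refine Finset.card_le_card_of_injOn (fun k => if k ≤ i then (k, 0) else (i, k - i)) ?_ ?_
    · intro k hk
      rw [Finset.mem_coe, Finset.mem_range] at hk
      rw [Finset.mem_coe, YoungDiagram.mem_cells]
      dsimp only
      split_ifs with h1
      · exact μ.up_left_mem h1 (Nat.zero_le _) h
      · exact μ.up_left_mem le_rfl (by omega) h
    · intro k _ l _ hkl
      simp only at hkl
      split_ifs at hkl <;> simp only [Prod.mk.injEq] at hkl <;> omega
  rw [Finset.card_range] at this
  exact this

theorem finite_area_eq (N : ℕ) : {μ : YoungDiagram | area μ = N}.Finite := by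
  refine Set.Finite.of_finite_image (f := YoungDiagram.cells)
    (((Finset.range N ×ˢ Finset.range N).powerset.finite_toSet).subset ?_)
    (fun a _ b _ hab => YoungDiagram.ext hab)
  rintro _ ⟨μ, hμ, rfl⟩
  simp only [Finset.coe_powerset, Set.mem_preimage, Set.mem_powerset_iff, Finset.coe_subset]
  rintro ⟨i, j⟩ hx
  have h1 := add_lt_area ((YoungDiagram.mem_cells _).1 hx)
  rw [hμ] at h1
  simp only [Finset.mem_product, Finset.mem_range]
  omega

/-- The finite set of the partitions of size `N`. -/
noncomputable def partsOfSize (N : ℕ) : Finset YoungDiagram := (finite_area_eq N).toFinset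

theorem mem_partsOfSize {N : ℕ} {μ : YoungDiagram} : μ ∈ partsOfSize N ↔ area μ = N := by
  simp [partsOfSize]

/-- The number of cells with `a / (l + 1) ≤ r / s < (a + 1) / l`, where `a` is the arm and `l` the
leg. -/
def hPlus (r s : ℕ) (μ : YoungDiagram) : ℕ :=
  {x ∈ μ.cells | s * arm μ x ≤ r * (leg μ x + 1) ∧ r * leg μ x < s * (arm μ x + 1)}.card

/-- The number of cells with `a / (l + 1) < r / s ≤ (a + 1) / l`, where `a` is the arm and `l` the
leg. -/
def hMinus (r s : ℕ) (μ : YoungDiagram) : ℕ :=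
  {x ∈ μ.cells | s * arm μ x < r * (leg μ x + 1) ∧ r * leg μ x ≤ s * (arm μ x + 1)}.card

theorem pairSum_eq_hPlus (r s : ℕ) (w : List Bool) :
    pairSum r s (fun d => if 0 ≤ d ∧ d < (r : ℤ) + s then 1 else 0) w 0 = hPlus r s (diag w) := by
  rw [pairSum_eq_sum_cells, hPlus, Finset.card_filter]
  refine Finset.sum_congr rfl fun x _ => if_congr (and_congr ?_ ?_) rfl rfl
  · rw [sub_nonneg]
    exact_mod_cast Iff.rfl
  · zify
    constructor <;> intro h <;> linarith

theorem pairSum_eq_hMinus (r s : ℕ) (w : List Bool) :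
    pairSum r s (fun d => if 0 < d ∧ d ≤ (r : ℤ) + s then 1 else 0) w 0 = hMinus r s (diag w) := by
  rw [pairSum_eq_sum_cells, hMinus, Finset.card_filter]
  refine Finset.sum_congr rfl fun x _ => if_congr (and_congr ?_ ?_) rfl rfl
  · rw [sub_pos]
    exact_mod_cast Iff.rfl
  · zify
    constructor <;> intro h <;> linarith

theorem pairSum_one_eq_area (r s : ℤ) (w : List Bool) :
    pairSum r s (fun _ => 1) w 0 = area (diag w) := by
  rw [pairSum_eq_sum_cells, area, Finset.card_eq_sum_ones]

theorem exists_diag_eq {N A B : ℕ} {μ : YoungDiagram} (hμ : area μ = N) (hA : N ≤ A)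
    (hB : N ≤ B) : ∃ w : List Bool, w.count true = B ∧ w.count false = A ∧ diag w = μ := by
  have h0 : μ.rowLen 0 ≤ A := by
    by_contra hc
    have := add_lt_area (YoungDiagram.mem_iff_lt_rowLen.2 (not_le.1 hc))
    omega
  have h0' : ∀ i, B ≤ i → μ.rowLen i = 0 := by
    intro i hi
    by_contra hc
    have := add_lt_area (YoungDiagram.mem_iff_lt_rowLen.2 (Nat.pos_of_ne_zero hc))
    omega
  obtain ⟨w, h1, h2, h3⟩ :=
    exists_word A B μ.rowLen (fun i j hij => μ.rowLen_anti i j hij) h0 h0'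
  refine ⟨w, h1, h2, ?_⟩
  ext ⟨i, j⟩
  rw [YoungDiagram.mem_cells, YoungDiagram.mem_cells, mem_diag, h3, YoungDiagram.mem_iff_lt_rowLen]

/-- A sum over the partitions of size `N` as a sum over the boundary words in a large box. -/
theorem sum_words_eq_sum_partsOfSize {M : Type*} [AddCommMonoid M] (r s : ℤ) {N A B : ℕ}
    (hA : N ≤ A) (hB : N ≤ B) (G : YoungDiagram → M) :
    (∑ w ∈ words (A + B) with (w.count true = B ∧ w.count false = A) ∧
        pairSum r s (fun _ => 1) w 0 = N, G (diag w)) = ∑ μ ∈ partsOfSize N, G μ := by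
  refine Finset.sum_nbij diag ?_ ?_ ?_ fun _ _ => rfl
  · intro w hw
    rw [mem_partsOfSize, ← pairSum_one_eq_area r s]
    exact (Finset.mem_filter.1 hw).2.2
  · intro w hw w' hw' h
    have h1 := (Finset.mem_filter.1 hw).2.1
    have h2 := (Finset.mem_filter.1 hw').2.1
    exact diag_injective (h1.1.trans h2.1.symm) (h1.2.trans h2.2.symm) h
  · intro μ hμ
    have hμ' := mem_partsOfSize.1 hμ
    obtain ⟨w, h1, h2, h3⟩ := exists_diag_eq hμ' hA hB
    refine ⟨w, Finset.mem_coe.2 (Finset.mem_filter.2 ⟨?_, ⟨h1, h2⟩, ?_⟩), h3⟩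
    · rw [mem_words, ← h1, ← h2, add_comm, List.count_true_add_count_false]
    · rw [pairSum_one_eq_area, h3, hμ']

theorem sum_hPlus_eq_sum_hMinus {r s : ℕ} (hr : 0 < r) (hs : 0 < s) {t : ℝ} (ht : 0 < t) (N : ℕ) :
    ∑ μ ∈ partsOfSize N, t ^ hPlus r s μ = ∑ μ ∈ partsOfSize N, t ^ hMinus r s μ := by
  have hA : N ≤ r * N := Nat.le_mul_of_pos_left N hr
  have hB : N ≤ s * N := Nat.le_mul_of_pos_left N hs
  rw [← sum_words_eq_sum_partsOfSize r s hA hB, ← sum_words_eq_sum_partsOfSize r s hA hB]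
  simp only [← pairSum_eq_hPlus, ← pairSum_eq_hMinus]
  exact sum_closed_words (by omega) (by omega) ht _ _ _ (by push_cast; ring)

/-- Between two consecutive multiples of `1 / N!` there is no slope at which the statistic of a
partition of size `N` changes. -/
theorem hMinus_succ_eq_hPlus {N : ℕ} (j : ℕ) {μ : YoungDiagram} (hμ : area μ = N) :
    hMinus (j + 1) N.factorial μ = hPlus j N.factorial μ := by
  rw [hMinus, hPlus]
  congr 1
  refine Finset.filter_congr fun x hx => ?_
  have hN : leg μ x + 1 ≤ N := by
    have h1 : x.1 < μ.colLen x.2 :=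
      YoungDiagram.mem_iff_lt_colLen.1 ((YoungDiagram.mem_cells _).1 hx)
    have h2 : (μ.colLen x.2 - 1, x.2) ∈ μ := YoungDiagram.mem_iff_lt_colLen.2 (by omega)
    have := add_lt_area h2
    simp only [leg]
    omega
  refine and_congr ?_ ?_
  · obtain ⟨c, hc⟩ := Nat.dvd_factorial (Nat.succ_pos (leg μ x)) hN
    rw [hc, show leg μ x + 1 = (leg μ x).succ from rfl, mul_assoc, mul_comm (j + 1), mul_comm j,
      Nat.mul_lt_mul_left (Nat.succ_pos _), Nat.mul_le_mul_left_iff (Nat.succ_pos _),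
      Nat.lt_succ_iff]
  · rcases Nat.eq_zero_or_pos (leg μ x) with h0 | h0
    · rw [h0]
      have := Nat.factorial_pos N
      simp [this]
    · obtain ⟨c, hc⟩ := Nat.dvd_factorial h0 (by omega : leg μ x ≤ N)
      rw [hc, mul_assoc, mul_comm (j + 1), mul_comm j, Nat.mul_lt_mul_left h0,
        Nat.mul_le_mul_left_iff h0, Nat.succ_le_iff]

theorem sum_hPlus_eq_sum_hPlus_zero {t : ℝ} (ht : 0 < t) (N j : ℕ) :
    ∑ μ ∈ partsOfSize N, t ^ hPlus j N.factorial μ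
      = ∑ μ ∈ partsOfSize N, t ^ hPlus 0 N.factorial μ := by
  induction j with
  | zero => rfl
  | succ j ih =>
    rw [sum_hPlus_eq_sum_hMinus (Nat.succ_pos j) (Nat.factorial_pos N) ht, ← ih]
    exact Finset.sum_congr rfl fun μ hμ => by rw [hMinus_succ_eq_hPlus j (mem_partsOfSize.1 hμ)]

theorem hPlus_mul_eq_cStat (m : ℕ) {K : ℕ} (hK : 0 < K) (μ : YoungDiagram) :
    hPlus (m * K) K μ = cStat m μ := by
  rw [hPlus, cStat]
  congr 1
  refine Finset.filter_congr fun x _ => ?_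
  rw [mul_comm m K, mul_assoc, mul_assoc, Nat.mul_le_mul_left_iff hK, Nat.mul_lt_mul_left hK,
    Nat.lt_succ_iff, and_comm, mul_add, mul_one]

/-- At slope `0` the statistic counts the last cells of the rows. -/
theorem hPlus_zero_eq_colLen {K : ℕ} (hK : 0 < K) (μ : YoungDiagram) :
    hPlus 0 K μ = μ.colLen 0 := by
  rw [hPlus, ← Finset.card_range (μ.colLen 0)]
  symm
  refine Finset.card_nbij (fun i => (i, μ.rowLen i - 1)) ?_ ?_ ?_
  · intro i hi
    have h1 : (i, 0) ∈ μ := YoungDiagram.mem_iff_lt_colLen.2 (Finset.mem_range.1 hi)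
    have h2 := YoungDiagram.mem_iff_lt_rowLen.1 h1
    refine Finset.mem_coe.2 (Finset.mem_filter.2 ⟨?_, ?_, ?_⟩)
    · exact (YoungDiagram.mem_cells _).2 (YoungDiagram.mem_iff_lt_rowLen.2 (by omega))
    · have : arm μ (i, μ.rowLen i - 1) = 0 := by
        simp only [arm]
        omega
      simp [this]
    · simp [hK]
  · intro i _ j _ h
    exact (Prod.mk.inj h).1
  · rintro ⟨i, j⟩ hx
    obtain ⟨h1, h2, -⟩ := Finset.mem_filter.1 (Finset.mem_coe.1 hx)
    have h3 := YoungDiagram.mem_iff_lt_rowLen.1 ((YoungDiagram.mem_cells _).1 h1)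
    have h4 : arm μ (i, j) = 0 := by
      rw [zero_mul, Nat.le_zero, Nat.mul_eq_zero] at h2
      exact h2.resolve_left hK.ne'
    simp only [arm] at h4
    refine ⟨i, Finset.mem_coe.2 (Finset.mem_range.2 ?_), ?_⟩
    · exact YoungDiagram.mem_iff_lt_colLen.1 (μ.up_left_mem le_rfl (Nat.zero_le j)
        ((YoungDiagram.mem_cells _).1 h1))
    · simp only [Prod.mk.injEq, true_and]
      omega

/-- On the partitions of size `N`, the statistic `c_m` has the same distribution as the number of
parts. -/
theorem card_cStat_eq_card_colLen (m N b : ℕ) :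
    {μ ∈ partsOfSize N | cStat m μ = b}.card = {μ ∈ partsOfSize N | μ.colLen 0 = b}.card := by
  have key : (∑ μ ∈ partsOfSize N, (Polynomial.X : Polynomial ℝ) ^ cStat m μ)
      = ∑ μ ∈ partsOfSize N, Polynomial.X ^ μ.colLen 0 := by
    refine Polynomial.eq_of_infinite_eval_eq _ _ ((Set.Ioi_infinite (0 : ℝ)).mono fun t ht => ?_)
    have h1 := sum_hPlus_eq_sum_hPlus_zero (Set.mem_Ioi.1 ht) N (m * N.factorial)
    simp only [hPlus_mul_eq_cStat m (Nat.factorial_pos N),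
      hPlus_zero_eq_colLen (Nat.factorial_pos N)] at h1
    simpa [Polynomial.eval_finsetSum] using h1
  have h2 := congrArg (fun p => Polynomial.coeff p b) key
  simp only [Polynomial.finsetSum_coeff, Polynomial.coeff_X_pow, @eq_comm _ b, Finset.sum_boole]
    at h2
  exact_mod_cast h2

/-! ### The generating function of partitions by size and number of parts -/

theorem eq_of_rowLen_eq {μ ν : YoungDiagram} (h : ∀ i, μ.rowLen i = ν.rowLen i) : μ = ν := by
  ext ⟨i, j⟩
  rw [YoungDiagram.mem_cells, YoungDiagram.mem_cells, YoungDiagram.mem_iff_lt_rowLen,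
    YoungDiagram.mem_iff_lt_rowLen, h]

/-- The partition without its first row. -/
def tailRows (μ : YoungDiagram) : YoungDiagram where
  cells := {x ∈ μ.cells | 0 < x.1}.image fun x => (x.1 - 1, x.2)
  isLowerSet := by
    rintro ⟨i, j⟩ ⟨i', j'⟩ hle hx
    obtain ⟨hi, hj⟩ := Prod.mk_le_mk.1 hle
    simp only [Finset.coe_image, Finset.coe_filter, Set.mem_image, Set.mem_ofPred_eq, Prod.exists,
      Prod.mk.injEq, YoungDiagram.mem_cells] at hx ⊢
    obtain ⟨k, l, ⟨h1, h2⟩, rfl, rfl⟩ := hx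
    exact ⟨i' + 1, j', ⟨μ.up_left_mem (by omega) hj h1, by omega⟩, rfl, rfl⟩

theorem mem_tailRows {μ : YoungDiagram} {i j : ℕ} : (i, j) ∈ tailRows μ ↔ (i + 1, j) ∈ μ := by
  rw [← YoungDiagram.mem_cells]
  simp only [tailRows, Finset.mem_image, Finset.mem_filter, YoungDiagram.mem_cells, Prod.exists,
    Prod.mk.injEq]
  constructor
  · rintro ⟨k, l, ⟨h1, h2⟩, rfl, rfl⟩
    rwa [Nat.sub_add_cancel h2]
  · exact fun h => ⟨i + 1, j, ⟨h, by omega⟩, rfl, rfl⟩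

theorem rowLen_tailRows (μ : YoungDiagram) (i : ℕ) : (tailRows μ).rowLen i = μ.rowLen (i + 1) :=
  eq_of_forall_lt_iff fun j => by
    rw [← YoungDiagram.mem_iff_lt_rowLen, mem_tailRows, YoungDiagram.mem_iff_lt_rowLen]

theorem colLen_zero_eq {μ : YoungDiagram} (h : 0 < μ.rowLen 0) :
    μ.colLen 0 = (tailRows μ).colLen 0 + 1 :=
  eq_of_forall_lt_iff fun i => by
    cases i with
    | zero =>
      rw [← YoungDiagram.mem_iff_lt_colLen, YoungDiagram.mem_iff_lt_rowLen]
      omega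
    | succ i =>
      rw [← YoungDiagram.mem_iff_lt_colLen, Nat.add_lt_add_iff_right,
        ← YoungDiagram.mem_iff_lt_colLen, mem_tailRows]

theorem area_eq_rowLen_add (μ : YoungDiagram) : area μ = μ.rowLen 0 + area (tailRows μ) := by
  have h : μ.cells = (Finset.range (μ.rowLen 0)).image (fun j => (0, j))
      ∪ (tailRows μ).cells.image (fun x => (x.1 + 1, x.2)) := by
    ext ⟨i, j⟩
    rw [YoungDiagram.mem_cells]
    cases i with
    | zero => simp [YoungDiagram.mem_iff_lt_rowLen]
    | succ i => simp [mem_tailRows]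
  rw [area, h, Finset.card_union_of_disjoint, Finset.card_image_of_injective,
    Finset.card_image_of_injective, Finset.card_range, area]
  · rintro ⟨i, j⟩ ⟨i', j'⟩ h
    simpa using h
  · intro i j h
    simpa using h
  · rw [Finset.disjoint_left]
    rintro x h1 h2
    obtain ⟨j, -, rfl⟩ := Finset.mem_image.1 h1
    obtain ⟨y, -, h⟩ := Finset.mem_image.1 h2
    simp at h

theorem rowLen_zero_le_area (μ : YoungDiagram) : μ.rowLen 0 ≤ area μ := by
  rw [area_eq_rowLen_add]
  exact Nat.le_add_right _ _

theorem exists_tailRows_eq {ν : YoungDiagram} {k : ℕ} (h : ν.rowLen 0 ≤ k) :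
    ∃ μ : YoungDiagram, μ.rowLen 0 = k ∧ tailRows μ = ν := by
  obtain ⟨w, -, -, hw⟩ := exists_word k (area ν + 1) (fun i => Nat.casesOn i k ν.rowLen)
    (antitone_nat_of_succ_le fun i => by
      cases i with
      | zero => exact h
      | succ i => exact ν.rowLen_anti _ _ (Nat.le_succ i)) le_rfl fun i hi => by
        obtain ⟨i, rfl⟩ : ∃ i', i = i' + 1 := ⟨i - 1, by omega⟩
        by_contra hc
        have := add_lt_area (YoungDiagram.mem_iff_lt_rowLen.2 (Nat.pos_of_ne_zero hc))
        omega
  refine ⟨diag w, (rowLen_diag w 0).trans (congrFun hw 0), eq_of_rowLen_eq fun i => ?_⟩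
  rw [rowLen_tailRows, rowLen_diag, hw]

/-- The number of the partitions of size `a` with `b` parts, all of them at most `n`. -/
noncomputable def boundedCount (n a b : ℕ) : ℕ :=
  {μ ∈ partsOfSize a | μ.colLen 0 = b ∧ μ.rowLen 0 ≤ n}.card

/-- A largest part equal to `n + 1` can be removed. -/
theorem boundedCount_succ (n a b : ℕ) : boundedCount (n + 1) a b = boundedCount n a b
    + if n + 1 ≤ a ∧ 1 ≤ b then boundedCount (n + 1) (a - (n + 1)) (b - 1) else 0 := by
  classical
  have hsplit : {μ ∈ partsOfSize a | μ.colLen 0 = b ∧ μ.rowLen 0 ≤ n + 1}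
      = {μ ∈ partsOfSize a | μ.colLen 0 = b ∧ μ.rowLen 0 ≤ n}
        ∪ {μ ∈ partsOfSize a | μ.colLen 0 = b ∧ μ.rowLen 0 = n + 1} := by
    ext μ
    simp only [Finset.mem_filter, Finset.mem_union]
    constructor
    · rintro ⟨h1, h2, h3⟩
      rcases Nat.lt_or_ge n (μ.rowLen 0) with h | h
      · exact Or.inr ⟨h1, h2, by omega⟩
      · exact Or.inl ⟨h1, h2, h⟩
    · rintro (⟨h1, h2, h3⟩ | ⟨h1, h2, h3⟩)
      · exact ⟨h1, h2, by omega⟩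
      · exact ⟨h1, h2, h3.le⟩
  rw [boundedCount, hsplit, Finset.card_union_of_disjoint, boundedCount]
  · congr 1
    split_ifs with h
    · refine Finset.card_nbij tailRows ?_ ?_ ?_
      · intro μ hμ
        obtain ⟨h1, h2, h3⟩ := Finset.mem_filter.1 (Finset.mem_coe.1 hμ)
        rw [mem_partsOfSize] at h1
        have h4 := area_eq_rowLen_add μ
        have h5 := colLen_zero_eq (μ := μ) (by omega)
        refine Finset.mem_coe.2 (Finset.mem_filter.2 ⟨mem_partsOfSize.2 (by omega), by omega, ?_⟩)
        rw [rowLen_tailRows, ← h3]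
        exact μ.rowLen_anti _ _ (Nat.zero_le _)
      · intro μ hμ ν hν hμν
        obtain ⟨-, -, h3⟩ := Finset.mem_filter.1 (Finset.mem_coe.1 hμ)
        obtain ⟨-, -, h3'⟩ := Finset.mem_filter.1 (Finset.mem_coe.1 hν)
        refine eq_of_rowLen_eq fun i => ?_
        cases i with
        | zero => rw [h3, h3']
        | succ i => rw [← rowLen_tailRows, hμν, rowLen_tailRows]
      · intro ν hν
        obtain ⟨h1, h2, h3⟩ := Finset.mem_filter.1 (Finset.mem_coe.1 hν)
        obtain ⟨μ, h4, rfl⟩ := exists_tailRows_eq h3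
        rw [mem_partsOfSize] at h1
        have h5 := area_eq_rowLen_add μ
        have h6 := colLen_zero_eq (μ := μ) (by omega)
        exact ⟨μ, Finset.mem_coe.2 (Finset.mem_filter.2
          ⟨mem_partsOfSize.2 (by omega), by omega, h4⟩), rfl⟩
    · rw [Finset.card_eq_zero, Finset.filter_eq_empty_iff]
      rintro μ hμ ⟨h2, h3⟩
      rw [mem_partsOfSize] at hμ
      have h4 := rowLen_zero_le_area μ
      have h5 := colLen_zero_eq (μ := μ) (by omega)
      omega
  · rw [Finset.disjoint_left]
    intro μ h1 h2
    have := (Finset.mem_filter.1 h1).2.2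
    have := (Finset.mem_filter.1 h2).2.2
    omega

theorem boundedCount_zero (a b : ℕ) : boundedCount 0 a b = if a = 0 ∧ b = 0 then 1 else 0 := by
  have h0 : ∀ μ : YoungDiagram, μ.rowLen 0 ≤ 0 ↔ μ = ⊥ := by
    intro μ
    constructor
    · intro h
      ext ⟨i, j⟩
      rw [YoungDiagram.mem_cells, YoungDiagram.mem_cells, YoungDiagram.mem_iff_lt_rowLen]
      have := μ.rowLen_anti 0 i (Nat.zero_le i)
      simp only [YoungDiagram.notMem_bot, iff_false]
      omega
    · rintro rfl
      by_contra hc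
      exact YoungDiagram.notMem_bot _ (YoungDiagram.mem_iff_lt_rowLen.2 (not_le.1 hc))
  have hc : (⊥ : YoungDiagram).colLen 0 = 0 := by
    by_contra hc
    exact YoungDiagram.notMem_bot _ (YoungDiagram.mem_iff_lt_colLen.2 (Nat.pos_of_ne_zero hc))
  rw [boundedCount]
  split_ifs with h
  · rw [Finset.card_eq_one]
    refine ⟨⊥, ?_⟩
    ext μ
    simp only [Finset.mem_filter, Finset.mem_singleton, mem_partsOfSize]
    constructor
    · exact fun h => (h0 μ).1 h.2.2
    · rintro rfl
      exact ⟨by simp [area, h.1], by rw [hc, h.2], (h0 _).2 rfl⟩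
  · rw [Finset.card_eq_zero, Finset.filter_eq_empty_iff]
    rintro μ hμ ⟨h2, h3⟩
    obtain rfl := (h0 μ).1 h3
    rw [mem_partsOfSize] at hμ
    exact h ⟨by simpa [area] using hμ.symm, by rw [← h2, hc]⟩

/-- The exponent of the monomial `q ^ a t ^ b`. -/
noncomputable def expo (a b : ℕ) : Fin 2 →₀ ℕ := Finsupp.single 0 a + Finsupp.single 1 b

@[simp] theorem expo_apply_zero (a b : ℕ) : expo a b 0 = a := by simp [expo]

@[simp] theorem expo_apply_one (a b : ℕ) : expo a b 1 = b := by simp [expo]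

theorem eq_expo_iff {d : Fin 2 →₀ ℕ} {a b : ℕ} : d = expo a b ↔ d 0 = a ∧ d 1 = b := by
  rw [Finsupp.ext_iff, Fin.forall_fin_two, expo_apply_zero, expo_apply_one]

theorem expo_le_iff {d : Fin 2 →₀ ℕ} {a b : ℕ} : expo a b ≤ d ↔ a ≤ d 0 ∧ b ≤ d 1 := by
  rw [Finsupp.le_def, Fin.forall_fin_two, expo_apply_zero, expo_apply_one]

theorem qS_pow_mul_tS_pow (a b : ℕ) : qS ^ a * tS ^ b = MvPowerSeries.monomial (expo a b) 1 := by
  rw [qS, tS, MvPowerSeries.X_pow_eq, MvPowerSeries.X_pow_eq, MvPowerSeries.monomial_mul_monomial,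
    one_mul, expo]

theorem tS_mul_qS_pow (a : ℕ) : tS * qS ^ a = MvPowerSeries.monomial (expo a 1) 1 := by
  rw [← qS_pow_mul_tS_pow, pow_one, mul_comm]

/-- The generating function of all partitions by size and by the statistic `c`. -/
noncomputable def statSeries (c : YoungDiagram → ℕ) : Series :=
  fun d => ({μ ∈ partsOfSize (d 0) | c μ = d 1}.card : ℤ)

theorem coeff_statSeries (c : YoungDiagram → ℕ) (d : Fin 2 →₀ ℕ) :
    MvPowerSeries.coeff d (statSeries c) = ({μ ∈ partsOfSize (d 0) | c μ = d 1}.card : ℤ) := rfl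

theorem hasSum_statSeries (c : YoungDiagram → ℕ) :
    HasSum (fun μ : YoungDiagram => qS ^ area μ * tS ^ c μ) (statSeries c) := by
  rw [MvPowerSeries.WithPiTopology.hasSum_iff_hasSum_coeff]
  intro d
  have h : HasSum (fun μ : YoungDiagram => MvPowerSeries.coeff d (qS ^ area μ * tS ^ c μ))
      (∑ μ ∈ partsOfSize (d 0), MvPowerSeries.coeff d (qS ^ area μ * tS ^ c μ)) :=
    hasSum_sum_of_ne_finset_zero fun μ hμ => by
      rw [qS_pow_mul_tS_pow, MvPowerSeries.coeff_monomial, if_neg]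
      rw [eq_expo_iff]
      exact fun h => hμ (mem_partsOfSize.2 h.1.symm)
  have e : MvPowerSeries.coeff d (statSeries c)
      = ∑ μ ∈ partsOfSize (d 0), MvPowerSeries.coeff d (qS ^ area μ * tS ^ c μ) := by
    rw [coeff_statSeries, Finset.card_filter, Nat.cast_sum]
    refine Finset.sum_congr rfl fun μ hμ => ?_
    rw [qS_pow_mul_tS_pow, MvPowerSeries.coeff_monomial]
    simp [eq_expo_iff, mem_partsOfSize.1 hμ, eq_comm]
  rw [e]
  exact h

/-- The generating function, by size and number of parts, of the partitions with parts at most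
`n`. -/
noncomputable def boundedSeries (n : ℕ) : Series := fun d => (boundedCount n (d 0) (d 1) : ℤ)

theorem coeff_boundedSeries (n : ℕ) (d : Fin 2 →₀ ℕ) :
    MvPowerSeries.coeff d (boundedSeries n) = (boundedCount n (d 0) (d 1) : ℤ) := rfl

theorem boundedSeries_succ (n : ℕ) :
    boundedSeries (n + 1) = boundedSeries n + tS * qS ^ (n + 1) * boundedSeries (n + 1) := by
  ext d
  rw [map_add, tS_mul_qS_pow, MvPowerSeries.coeff_monomial_mul, coeff_boundedSeries,
    coeff_boundedSeries, coeff_boundedSeries, boundedCount_succ]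
  simp only [expo_le_iff, Finsupp.tsub_apply, expo_apply_zero, expo_apply_one]
  push_cast
  simp

theorem boundedSeries_zero : boundedSeries 0 = 1 := by
  ext d
  rw [coeff_boundedSeries, boundedCount_zero, MvPowerSeries.coeff_one]
  have : d = 0 ↔ d 0 = 0 ∧ d 1 = 0 := by
    rw [← eq_expo_iff]
    simp [expo]
  simp [this]

theorem one_sub_mul_geomFactor (i : ℕ) : (1 - tS * qS ^ i) * geomFactor i = 1 := by
  refine MvPowerSeries.mul_invOfUnit _ _ ?_
  simp [tS]

theorem boundedSeries_eq_prod (n : ℕ) :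
    boundedSeries n = ∏ i ∈ Finset.range n, geomFactor (i + 1) := by
  induction n with
  | zero => simp [boundedSeries_zero]
  | succ n ih =>
    rw [Finset.prod_range_succ, ← ih]
    have h1 := boundedSeries_succ n
    have h2 := one_sub_mul_geomFactor (n + 1)
    calc boundedSeries (n + 1)
        = ((1 - tS * qS ^ (n + 1)) * geomFactor (n + 1)) * boundedSeries (n + 1) := by
          rw [h2, one_mul]
      _ = (boundedSeries (n + 1) - tS * qS ^ (n + 1) * boundedSeries (n + 1))
            * geomFactor (n + 1) := by ring
      _ = boundedSeries n * geomFactor (n + 1) := by rw [sub_eq_of_eq_add h1]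

theorem multipliable_geomFactor : Multipliable fun i : ℕ => geomFactor (i + 1) := by
  have h : ∀ i, geomFactor (i + 1) = 1 + tS * qS ^ (i + 1) * geomFactor (i + 1) := fun i => by
    linear_combination one_sub_mul_geomFactor (i + 1)
  rw [funext h]
  refine MvPowerSeries.WithPiTopology.multipliable_one_add_of_tendsto_order_atTop_nhds_top ?_
  rw [ENat.tendsto_nhds_top_iff_natCast_lt]
  intro N
  filter_upwards [Filter.eventually_ge_atTop N] with i hi
  have h1 : ((i + 1 : ℕ) : ℕ∞) ≤ (tS * qS ^ (i + 1) * geomFactor (i + 1)).order := by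
    refine MvPowerSeries.nat_le_order fun d hd => ?_
    rw [tS_mul_qS_pow, MvPowerSeries.coeff_monomial_mul, if_neg]
    rw [expo_le_iff]
    rintro ⟨h1, -⟩
    have := Finsupp.le_degree 0 d
    omega
  refine lt_of_lt_of_le ?_ h1
  exact_mod_cast Nat.lt_succ_of_le hi

theorem tprod_geomFactor : ∏' i : ℕ, geomFactor (i + 1) = statSeries fun μ => μ.colLen 0 := by
  refine tendsto_nhds_unique multipliable_geomFactor.hasProd.tendsto_prod_nat ?_
  simp only [← boundedSeries_eq_prod]
  rw [MvPowerSeries.WithPiTopology.tendsto_iff_coeff_tendsto]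
  intro d
  refine tendsto_const_nhds.congr' ?_
  filter_upwards [Filter.eventually_ge_atTop (d 0)] with n hn
  rw [coeff_statSeries, coeff_boundedSeries, boundedCount]
  congr 2
  refine Finset.filter_congr fun μ hμ => ?_
  have h1 := rowLen_zero_le_area μ
  rw [mem_partsOfSize.1 hμ] at h1
  simp [h1.trans hn]

theorem statSeries_cStat (m : ℕ) :
    statSeries (cStat m) = statSeries fun μ => μ.colLen 0 := by
  ext d
  rw [coeff_statSeries, coeff_statSeries, card_cStat_eq_card_colLen]

/-! ### The modified higher Catalan numbers and their limit -/

theorem mem_Par {m n : ℕ} {μ : YoungDiagram} : μ ∈ Par m n ↔ FitsTriangle m n μ := by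
  simp [Par]

theorem modifiedPC_eq (m n : ℕ) :
    modifiedPC m n = ∑ μ ∈ Par m n, qL ^ area μ * tL ^ cStat m μ := by
  rw [modifiedPC, PC, map_sum, Finset.mul_sum]
  refine Finset.sum_congr rfl fun μ hμ => ?_
  have h1 : area μ + areaC m n μ = m * n.choose 2 := Nat.add_sub_cancel' (area_le hμ)
  have h2 : qL * qInvL = 1 := by
    rw [qL, qInvL, ← LaurentPolynomial.T_add]
    simp
  simp only [map_mul, map_pow, MvPolynomial.aeval_X, Matrix.cons_val_zero, Matrix.cons_val_one]
  rw [← h1, pow_add, mul_assoc, ← mul_assoc (qL ^ areaC m n μ), ← mul_pow, h2, one_pow, one_mul]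

theorem qL_pow_mul_tL_pow (a b : ℕ) :
    qL ^ a * tL ^ b = AddMonoidAlgebra.single (a : ℤ) (Polynomial.X ^ b) := by
  rw [LaurentPolynomial.single_eq_C_mul_T, qL, tL, LaurentPolynomial.T_pow, ← map_pow, mul_comm,
    mul_one]

theorem coeff_modifiedPC (m n : ℕ) (k : ℤ) : (modifiedPC m n).coeff k
    = ∑ μ ∈ Par m n, if (area μ : ℤ) = k then (Polynomial.X : Polynomial ℤ) ^ cStat m μ else 0 := by
  rw [modifiedPC_eq, AddMonoidAlgebra.coeff_sum, Finsupp.finsetSum_apply]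
  refine Finset.sum_congr rfl fun μ _ => ?_
  rw [qL_pow_mul_tL_pow, AddMonoidAlgebra.coeff_single, Finsupp.single_apply]

/-- Every partition fits in all large triangles. -/
theorem fitsTriangle_of_area_lt {m n : ℕ} (hm : 0 < m) {μ : YoungDiagram} (h : area μ < n) :
    FitsTriangle m n μ := by
  rintro ⟨i, j⟩ hx
  have h1 := add_lt_area ((YoungDiagram.mem_cells _).1 hx)
  have h2 : (0 : ℤ) ≤ (n : ℤ) - ((i : ℤ) + 1) := by omega
  have h3 : (1 : ℤ) * ((n : ℤ) - ((i : ℤ) + 1)) ≤ (m : ℤ) * ((n : ℤ) - ((i : ℤ) + 1)) :=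
    mul_le_mul_of_nonneg_right (by omega) h2
  simp only
  omega

theorem hasFormalLimit_modifiedPC {m : ℕ} (hm : 0 < m) :
    HasFormalLimit (fun n => modifiedPC m n) (statSeries (cStat m)) := by
  constructor
  · refine Filter.Eventually.of_forall fun n k hk => ?_
    rw [coeff_modifiedPC]
    exact Finset.sum_eq_zero fun μ _ => if_neg (by omega)
  · intro a b
    filter_upwards [Filter.eventually_gt_atTop a] with n hn
    have hP : {μ ∈ Par m n | area μ = a} = partsOfSize a := by
      ext μ
      rw [Finset.mem_filter, mem_Par, mem_partsOfSize, and_iff_right_iff_imp]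
      exact fun h => fitsTriangle_of_area_lt hm (h ▸ hn)
    change _ = MvPowerSeries.coeff (expo a b) _
    rw [coeff_modifiedPC, coeff_statSeries, expo_apply_zero, expo_apply_one]
    simp only [Nat.cast_inj]
    rw [← Finset.sum_filter, hP, Polynomial.finsetSum_coeff, Finset.card_filter, Nat.cast_sum]
    refine Finset.sum_congr rfl fun μ _ => ?_
    rw [Polynomial.coeff_X_pow]
    simp [eq_comm]

end HigherCatalan

theorem proposition2p2 :
    (∀ m n : ℕ, 0 < m → 0 < n →
      HigherCatalan.modifiedPC m n =
        ∑ μ ∈ HigherCatalan.Par m n,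
          HigherCatalan.qL ^ HigherCatalan.area μ * HigherCatalan.tL ^ HigherCatalan.cStat m μ) ∧
    (∀ m : ℕ, 0 < m →
      Summable (fun μ : YoungDiagram =>
        HigherCatalan.qS ^ HigherCatalan.area μ * HigherCatalan.tS ^ HigherCatalan.cStat m μ) ∧
      Multipliable (fun i : ℕ => HigherCatalan.geomFactor (i + 1)) ∧
      HigherCatalan.HasFormalLimit (fun n => HigherCatalan.modifiedPC m n)
        (∑' μ : YoungDiagram,
          HigherCatalan.qS ^ HigherCatalan.area μ * HigherCatalan.tS ^ HigherCatalan.cStat m μ) ∧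
      (∑' μ : YoungDiagram,
          HigherCatalan.qS ^ HigherCatalan.area μ * HigherCatalan.tS ^ HigherCatalan.cStat m μ) =
        ∏' i : ℕ, HigherCatalan.geomFactor (i + 1)) := by
  refine ⟨fun m n _ _ => HigherCatalan.modifiedPC_eq m n, fun m hm => ?_⟩
  have h := HigherCatalan.hasSum_statSeries (HigherCatalan.cStat m)
  rw [h.tsum_eq, HigherCatalan.tprod_geomFactor]
  exact ⟨h.summable, HigherCatalan.multipliable_geomFactor,
    HigherCatalan.hasFormalLimit_modifiedPC hm, HigherCatalan.statSeries_cStat m⟩
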